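/- Let $P$ be a finite $(\mathbf 3+\mathbf 1)$-free poset, i.e. $P$ has no elements $a<b<c$ and $d$ with $d$ incomparable to each of $a,b,c$. Let $\mathrm{inc}(P)$ be its incomparability graph, and let $X_{\mathrm{inc}(P)}(\mathbf x)=\sum_\kappa\prod_{v\in P}x_{\kappa(v)}$ be its chromatic symmetric function, the sum being over all proper colorings $\kappa$ of $\mathrm{inc}(P)$ by positive integers. Then $X_{\mathrm{inc}(P)}$ has a unique expansion $X_{\mathrm{inc}(P)}=\sum_\lambda c^P_\lambda e_\lambda$ with integer coefficients $c^P_\lambda$ (a finite sum over integer partitions $\lambda$) in the products $e_\lambda=e_{\lambda_1}e_{\lambda_2}\cdots$ of elementary symmetric functions, and for all integers $r,c\ge 0$, $$c^P_{(r^c)}=\#\{\text{standard cylindric } P\text{-tableaux of shape } (r^c)/\varnothing/0\}.$$ Here $(r^c)$ is the partition with $c$ parts equal to $r$ (the empty partition if $rc=0$). For a cylindric shape $\lambda/\mu/d$, that is, partitions $\mu\subset\lambda$ and an integer $d$ with $\max(\lambda'_1-\lambda'_{\lambda_1},\,\mu'_1-\mu'_{\lambda_1})\le d\le\lambda'_1$,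 where $'$ denotes the transpose, a filling $T$ of the skew diagram $\lambda/\mu$ with elements of a poset $Q$ is a *cylindric $Q$-tableau* if the filling $T^d$, obtained by gluing a copy of the first column of $T$ to the right of the last column of $T$, shifted up by $d$ cells, is a $Q$-tableau: entries satisfy $T^d(i,j)<_Q T^d(i+1,j)$ and $T^d(i,j)\not>_Q T^d(i,j+1)$ whenever both cells belong to the diagram. It is *standard* if it contains each element of $Q$ exactly once. For the shape $(r^c)/\varnothing/0$ this says that $T$ increases strictly down columns and that no entry is greater than the next entry of its row, the rows being read cyclically. Moreover, for all integers $r,c\ge 0$ the cylindric Schur function $s_{(r^c)/\varnothing/0}(\mathbf x)=\sum_T\prod_b x_{T(b)}$, summed over all cylindric $\mathbb Z_{>0}$-tableaux $T$ of shape $(r^c)/\varnothing/0$, equals the monomial symmetric function $m_{(r^c)}(\mathbf x)$. -/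

import Mathlib

noncomputable section

namespace CylPTab

/-! ### Posets and chromatic symmetric functions -/

/-- `P` has no induced subposet isomorphic to the disjoint union of a three-element chain
and a single element. -/
def ThreePlusOneFree (P : Type*) [PartialOrder P] : Prop :=
  ∀ a b c d : P, a < b → b < c →
    ¬ (IncompRel (· ≤ ·) a d ∧ IncompRel (· ≤ ·) b d ∧ IncompRel (· ≤ ·) c d)

/-- The incomparability graph of a poset. -/
def incGraph (P : Type*) [PartialOrder P] : SimpleGraph P where
  Adj a b := IncompRel (· ≤ ·) a b
  symm := ⟨fun _ _ h => ⟨h.2, h.1⟩⟩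
  loopless := ⟨fun _ h => h.1 le_rfl⟩

/-- The exponent vector of the monomial `∏ b, x_{f b}` attached to a filling or colouring `f`.
The variables are indexed by `ℕ`, so the colours are `0, 1, 2, …`. -/
def weight {B : Type*} [Fintype B] (f : B → ℕ) : ℕ →₀ ℕ :=
  ∑ b, Finsupp.single (f b) 1

/-- The chromatic symmetric function `∑ κ, ∏ v, x_{κ v}` over all proper colourings `κ`, a formal
power series in countably many variables: the coefficient of a monomial is the (finite) number of
proper colourings with that weight. -/
def chromaticSymm {V : Type*} [Fintype V] (G : SimpleGraph V) : MvPowerSeries ℕ ℤ :=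
  fun m => (Nat.card {κ : G.Coloring ℕ // weight κ = m} : ℤ)

/-! ### Symmetric functions; partitions are given by their Young diagrams -/

open Classical in
/-- The elementary symmetric function `e_k`: the sum of all squarefree monomials of degree `k`. -/
def elemSymm (k : ℕ) : MvPowerSeries ℕ ℤ :=
  fun m => if (∀ i, m i ≤ 1) ∧ m.support.card = k then 1 else 0

/-- `e_lam`, the product of the `e_k` over the parts `k` of `lam`. -/
def elemSymmPart (lam : YoungDiagram) : MvPowerSeries ℕ ℤ :=
  (lam.rowLens.map elemSymm).prod

open Classical in
/-- The monomial symmetric function `m_lam`: the sum of all monomials whose nonzero exponents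
are, as a multiset, the parts of `lam`. -/
def monoSymm (lam : YoungDiagram) : MvPowerSeries ℕ ℤ :=
  fun m => if m.support.val.map m = (lam.rowLens : Multiset ℕ) then 1 else 0

/-- `a` is a family of coefficients of an `e`-expansion of `f`, that is
`f = ∑ lam, a lam * e_lam`, a finite sum over partitions of arbitrary size. -/
def IsElemExpansion (f : MvPowerSeries ℕ ℤ) (a : YoungDiagram →₀ ℤ) : Prop :=
  f = a.sum fun lam z => z • elemSymmPart lam

/-! ### Cylindric `P`-tableaux -/

/-- The boxes `(row, column)`, counted from `0`, of the skew shape `lam / mu`. -/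
abbrev SkewCell (lam mu : YoungDiagram) : Type := ↥(lam.cells \ mu.cells)

/-- A filling of `lam / mu` is a `P`-tableau if it increases down columns and never
decreases from a box to the next one in its row. -/
def IsPTableau {P : Type*} [PartialOrder P] {lam mu : YoungDiagram}
    (T : SkewCell lam mu → P) : Prop :=
  (∀ (i j : ℕ) (h : (i, j) ∈ lam.cells \ mu.cells) (h' : (i + 1, j) ∈ lam.cells \ mu.cells),
    T ⟨(i, j), h⟩ < T ⟨(i + 1, j), h'⟩) ∧
  (∀ (i j : ℕ) (h : (i, j) ∈ lam.cells \ mu.cells) (h' : (i, j + 1) ∈ lam.cells \ mu.cells),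
    ¬ T ⟨(i, j + 1), h'⟩ < T ⟨(i, j), h⟩)

/-- A cylindric shape `lam / mu / d`. The length of the first row of `lam` is `outer.rowLen 0`,
and the length of column `j` of a diagram, counted from `0`, is `colLen j`. -/
structure CylindricShape where
  outer : YoungDiagram
  inner : YoungDiagram
  shift : ℕ
  inner_le : inner ≤ outer
  outer_shift : outer.colLen 0 - outer.colLen (outer.rowLen 0 - 1) ≤ shift
  inner_shift : inner.colLen 0 - inner.colLen (outer.rowLen 0 - 1) ≤ shift
  shift_le : shift ≤ outer.colLen 0

/-- The partition whose column lengths are `(kap'_1 + d, …, kap'_l + d, kap'_1)`. -/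
def glueDiagram (kap : YoungDiagram) (l d : ℕ)
    (h : kap.colLen 0 - kap.colLen (l - 1) ≤ d) : YoungDiagram where
  cells := (Finset.range (kap.colLen 0 + d) ×ˢ Finset.range (l + 1)).filter
    fun x => x.1 < if x.2 < l then kap.colLen x.2 + d else kap.colLen 0
  isLowerSet := by
    rintro ⟨i, j⟩ ⟨i', j'⟩ hle hx
    obtain ⟨hi : i' ≤ i, hj : j' ≤ j⟩ := hle
    simp only [Finset.coe_filter, Finset.mem_product, Finset.mem_range, Set.mem_ofPred_eq] at hx ⊢
    obtain ⟨⟨h1, h2⟩, h3⟩ := hx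
    refine ⟨⟨by omega, by omega⟩, ?_⟩
    by_cases hl : j < l
    · have := kap.colLen_anti j' j hj
      rw [if_pos hl] at h3
      rw [if_pos (by omega)]
      omega
    · rw [if_neg hl] at h3
      split_ifs with hl'
      · have := kap.colLen_anti j' (l - 1) (by omega)
        omega
      · omega

theorem mem_glueDiagram {kap : YoungDiagram} {l d : ℕ}
    {h : kap.colLen 0 - kap.colLen (l - 1) ≤ d} {i j : ℕ} :
    (i, j) ∈ (glueDiagram kap l d h).cells ↔
      (j < l ∧ i < kap.colLen j + d) ∨ (j = l ∧ i < kap.colLen 0) := by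
  have := kap.colLen_anti 0 j (Nat.zero_le _)
  simp only [glueDiagram, Finset.mem_filter, Finset.mem_product, Finset.mem_range]
  split_ifs with hl <;> omega

/-- The outer diagram of the shape of `T^d`. -/
def CylindricShape.gluedOuter (S : CylindricShape) : YoungDiagram :=
  glueDiagram S.outer (S.outer.rowLen 0) S.shift S.outer_shift

/-- The inner diagram of the shape of `T^d`. -/
def CylindricShape.gluedInner (S : CylindricShape) : YoungDiagram :=
  glueDiagram S.inner (S.outer.rowLen 0) S.shift S.inner_shift

/-- The box of `lam / mu` whose entry is copied into a given box of the shape of `T^d`: the old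
columns have moved down by `d` rows, and the added last column is a copy of the first one. -/
def CylindricShape.unglue (S : CylindricShape) (x : SkewCell S.gluedOuter S.gluedInner) :
    SkewCell S.outer S.inner :=
  ⟨if x.1.2 < S.outer.rowLen 0 then (x.1.1 - S.shift, x.1.2) else (x.1.1, 0), by
    obtain ⟨⟨i, j⟩, hx⟩ := x
    rw [Finset.mem_sdiff, CylindricShape.gluedOuter, CylindricShape.gluedInner,
      mem_glueDiagram, mem_glueDiagram] at hx
    dsimp only
    split_ifs with hl
    · rw [Finset.mem_sdiff, YoungDiagram.mem_cells, YoungDiagram.mem_cells,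
        YoungDiagram.mem_iff_lt_colLen, YoungDiagram.mem_iff_lt_colLen]
      omega
    · rw [Finset.mem_sdiff, YoungDiagram.mem_cells, YoungDiagram.mem_cells,
        YoungDiagram.mem_iff_lt_colLen, YoungDiagram.mem_iff_lt_colLen]
      omega⟩

/-- The filling `T^d`: a copy of the first column of `T` is glued to the last column of `T`,
shifted up by `d` boxes. -/
def CylindricShape.glue {P : Type*} (S : CylindricShape) (T : SkewCell S.outer S.inner → P) :
    SkewCell S.gluedOuter S.gluedInner → P :=
  fun x => T (S.unglue x)

/-- `T` is a cylindric `P`-tableau if `T^d` is a `P`-tableau. -/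
def IsCylindricPTableau {P : Type*} [PartialOrder P] (S : CylindricShape)
    (T : SkewCell S.outer S.inner → P) : Prop :=
  IsPTableau (S.glue T)

/-- The standard cylindric `P`-tableaux: those that contain each element of `P` exactly once. -/
def StandardCylindricPTableau (P : Type*) [PartialOrder P] (S : CylindricShape) : Type _ :=
  {T : SkewCell S.outer S.inner → P // IsCylindricPTableau S T ∧ ∀ p, ∃! b, T b = p}

/-- The cylindric Schur function: the generating function of the cylindric semistandard Young
tableaux, that is, of the cylindric `P`-tableaux for the total order `P = ℕ`. -/
def cylindricSchur (S : CylindricShape) : MvPowerSeries ℕ ℤ :=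
  fun m => (Nat.card
    {T : SkewCell S.outer S.inner → ℕ // IsCylindricPTableau S T ∧ weight T = m} : ℤ)

/-! ### Rectangles -/

/-- The partition `(r^c)`, with `c` rows of length `r`. -/
def rect (r c : ℕ) : YoungDiagram where
  cells := Finset.range c ×ˢ Finset.range r
  isLowerSet := by
    rintro ⟨i, j⟩ ⟨i', j'⟩ hle hx
    obtain ⟨hi : i' ≤ i, hj : j' ≤ j⟩ := hle
    simp only [Finset.mem_coe, Finset.mem_product, Finset.mem_range] at hx ⊢
    omega

theorem mem_rect {r c i j : ℕ} : (i, j) ∈ rect r c ↔ i < c ∧ j < r := by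
  rw [← YoungDiagram.mem_cells]
  simp [rect]

theorem rect_shift (r c : ℕ) :
    (rect r c).colLen 0 - (rect r c).colLen ((rect r c).rowLen 0 - 1) ≤ 0 := by
  rw [Nat.sub_eq_zero_of_le]
  by_contra! hlt
  have h0 := YoungDiagram.mem_iff_lt_colLen.mpr hlt
  have h1 := mem_rect.mp h0
  have h2 : ((rect r c).colLen ((rect r c).rowLen 0 - 1), (rect r c).rowLen 0 - 1)
      ∉ rect r c := by
    rw [YoungDiagram.mem_iff_lt_colLen]
    exact lt_irrefl _
  have h3 : (0, (rect r c).rowLen 0 - 1) ∈ rect r c := by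
    have h4 : (0, 0) ∈ rect r c := mem_rect.mpr (by omega)
    rw [YoungDiagram.mem_iff_lt_rowLen] at h4 ⊢
    omega
  rw [mem_rect] at h2 h3
  omega

/-- The cylindric shape `(r^c) / ∅ / 0`. -/
def rectShape (r c : ℕ) : CylindricShape where
  outer := rect r c
  inner := ⊥
  shift := 0
  inner_le := bot_le
  outer_shift := rect_shift r c
  inner_shift := by
    have h : (⊥ : YoungDiagram).colLen 0 = 0 := by
      by_contra hne
      exact YoungDiagram.notMem_bot _
        (YoungDiagram.mem_iff_lt_colLen.mpr (Nat.pos_of_ne_zero hne))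
    rw [h, Nat.zero_sub]
  shift_le := Nat.zero_le _

end CylPTab

end

set_option linter.unusedSectionVars false

/-! Keep `r` variables and set them equal to the distinct `r`-th roots of unity `z_i`. They are the
roots of `X^r - 1`, so `e_k` vanishes for `0 < k ≠ r`, and `e_r` becomes `∏ z_i`. If `|P| = rc`, all
that survives of the `e`-expansion is `a (r^c) * (∏ z_i)^c` (`sum_coloring_eq_coeff`). If `|P| ≠
rc`, both sides of the claim are zero for degree reasons.

The same specialization can be counted by tableaux. Sorting colour classes turns proper colourings
into `P`-arrays with column lengths `k_j`. Multiplying by `det (z_i^(-j))` turns the sum over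
colourings into the sum over arrays of `det (z_i^(k_j - j))` (`sum_coloring_mul_det`). Since `z_i^r
= 1`, exponents only matter modulo `r`, so this determinant changes sign under `(k_j, k_{j+1}) ↦
(k_{j+1} - 1, k_j + 1)` for cyclically adjacent columns too, the last and the first included.
Gasharov's exchange of column tails has exactly this effect on lengths, and freeness from `3 + 1`
keeps the columns increasing.

With cyclic adjacency no flaw is distinguished as the last in its row, so the cancellation goes row
by row through inclusion-exclusion over sets `t` of flawed positions. A row cannot be flawed
everywhere, as that would give a cyclic strictly decreasing sequence in `P`. For `t` nonempty and
proper, an exchange at a `j ∈ t` with `j - 1 ∉ t` preserves all flaws in `t` and is a sign-reversing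
involution (`sum_flawed_eq_zero`, `sum_array_eq`). The surviving arrays have cyclically weakly
decreasing, hence constant, column lengths `c`. They are the standard cylindric tableaux, and each
contributes `(∏ z_i)^c * det (z_i^(-j))`. Cancelling the nonzero Vandermonde factor gives
`sum_coloring_eq_card_tableaux`.

The `e`-expansion exists and is unique by the fundamental theorem of symmetric polynomials, after
truncation to finitely many variables. For the cylindric Schur function, a cyclically weakly
increasing row of integers is constant. -/

noncomputable section

namespace CylPTab

/-! ### Gasharov's exchange of column tails -/

section Arrays

variable {P C : Type*} [PartialOrder P]

/-- A `P`-array: the elements of `P` are placed in columns indexed by `C`, each column being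
top-justified and increasing. The value `(j, m)` means column `j` and row `m`. -/
structure IsArray (f : P → C × ℕ) : Prop where
  inj : Function.Injective f
  down : ∀ v j m, f v = (j, m + 1) → ∃ u, f u = (j, m)
  incr : ∀ u v j m, f u = (j, m) → f v = (j, m + 1) → u < v

/-- The columns `a` and `b` violate the row condition of tableaux in row `i`. -/
def FlawAt (f : P → C × ℕ) (a b : C) (i : ℕ) : Prop :=
  ∃ u, f u = (b, i) ∧ ∀ v, f v = (a, i) → u < v

open Classical in
/-- The map of boxes that exchanges the boxes of column `a` from row `i` on with the boxes of
column `b` from row `i + 1` on. -/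
def swapCell (a b : C) (i : ℕ) (x : C × ℕ) : C × ℕ :=
  if x.1 = a ∧ i ≤ x.2 then (b, x.2 + 1)
  else if x.1 = b ∧ i + 1 ≤ x.2 then (a, x.2 - 1) else x

theorem swapCell_left {a b : C} {i m : ℕ} (h : i ≤ m) : swapCell a b i (a, m) = (b, m + 1) := by
  simp [swapCell, h]

theorem swapCell_right {a b : C} {i m : ℕ} (hab : a ≠ b) (h : i ≤ m) :
    swapCell a b i (b, m + 1) = (a, m) := by
  simp [swapCell, h, hab.symm]

theorem swapCell_left_lt {a b : C} {i m : ℕ} (hab : a ≠ b) (h : m < i) :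
    swapCell a b i (a, m) = (a, m) := by
  simp [swapCell, h, hab]

theorem swapCell_right_le {a b : C} {i m : ℕ} (hab : a ≠ b) (h : m ≤ i) :
    swapCell a b i (b, m) = (b, m) := by
  simp [swapCell, hab.symm]; omega

theorem swapCell_other {a b c : C} {i m : ℕ} (ha : c ≠ a) (hb : c ≠ b) :
    swapCell a b i (c, m) = (c, m) := by
  simp [swapCell, ha, hb]

theorem swapCell_involutive {a b : C} (hab : a ≠ b) (i : ℕ) :
    Function.Involutive (swapCell a b i) := by
  rintro ⟨c, m⟩
  by_cases hca : c = a
  · subst hca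
    rcases lt_or_ge m i with h | h
    · rw [swapCell_left_lt hab h, swapCell_left_lt hab h]
    · rw [swapCell_left h, swapCell_right hab h]
  · by_cases hcb : c = b
    · subst hcb
      rcases m with _ | m
      · rw [swapCell_right_le hab (by omega), swapCell_right_le hab (by omega)]
      · rcases lt_or_ge m i with h | h
        · rw [swapCell_right_le hab (by omega), swapCell_right_le hab (by omega)]
        · rw [swapCell_right hab h, swapCell_left h]
    · rw [swapCell_other hca hcb, swapCell_other hca hcb]

theorem swapCell_comp_eq_iff {a b : C} (hab : a ≠ b) {i : ℕ} {f : P → C × ℕ} {v : P}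
    {x : C × ℕ} : (swapCell a b i ∘ f) v = x ↔ f v = swapCell a b i x :=
  (swapCell_involutive hab i).eq_iff

theorem FlawAt.ne {f : P → C × ℕ} {a b : C} {i : ℕ} (h : FlawAt f a b i) : a ≠ b := by
  rintro rfl
  obtain ⟨u, hu, h⟩ := h
  exact lt_irrefl _ (h u hu)

theorem IsArray.down_le {f : P → C × ℕ} (hf : IsArray f) {j : C} {m n : ℕ} (hmn : m ≤ n)
    (h : ∃ v, f v = (j, n)) : ∃ u, f u = (j, m) := by
  induction n, hmn using Nat.le_induction with
  | base => exact h
  | succ n _ ih =>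
    obtain ⟨v, hv⟩ := h
    exact ih (hf.down v j n hv)

theorem IsArray.lt_of_lt {f : P → C × ℕ} (hf : IsArray f) {j : C} {m n : ℕ} (hmn : m < n)
    {u v : P} (hu : f u = (j, m)) (hv : f v = (j, n)) : u < v := by
  induction n, hmn using Nat.le_induction generalizing v with
  | base => exact hf.incr u v j m hu hv
  | succ n _ ih =>
    obtain ⟨w, hw⟩ := hf.down v j n hv
    exact (ih hw).trans (hf.incr w v j n hw hv)

theorem exists_of_not_flawAt {f : P → C × ℕ} {a b : C} {i : ℕ} (h : ¬ FlawAt f a b i) {u : P}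
    (hu : f u = (b, i)) : ∃ v, f v = (a, i) ∧ ¬ u < v := by
  by_contra! h'
  exact h ⟨u, hu, h'⟩

/-- Only two new vertical adjacencies arise. In column `b` the new one is increasing because row `i`
is flawed. In column `a` it joins row `i - 1` of `a` to row `i + 1` of `b`, and there the absence of
a flaw in row `i - 1` combines with freeness from `3 + 1`. -/
theorem IsArray.swap (hP : ThreePlusOneFree P) {f : P → C × ℕ} (hf : IsArray f) {a b : C}
    {i : ℕ} (hlow : ∀ i' < i, ¬ FlawAt f a b i') (hi : FlawAt f a b i) :
    IsArray (swapCell a b i ∘ f) := by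
  have hab := hi.ne
  obtain ⟨u₀, hu₀, hflaw⟩ := hi
  refine ⟨(swapCell_involutive hab i).injective.comp hf.inj, ?_, ?_⟩
  · intro v j m hv
    rw [swapCell_comp_eq_iff hab] at hv
    simp only [swapCell_comp_eq_iff hab]
    by_cases hja : j = a
    · subst hja
      rcases lt_or_ge m i with h | h
      · rw [swapCell_left_lt hab h]
        obtain ⟨u, hu⟩ := hf.down_le h.le ⟨u₀, hu₀⟩
        obtain ⟨w, hw, -⟩ := exists_of_not_flawAt (hlow m h) hu
        exact ⟨w, hw⟩
      · rw [swapCell_left (by omega)] at hv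
        rw [swapCell_left h]
        exact hf.down _ _ _ hv
    · by_cases hjb : j = b
      · subst hjb
        rcases lt_or_ge m i with h | h
        · rw [swapCell_right_le hab h.le]
          exact hf.down_le h.le ⟨u₀, hu₀⟩
        · rw [swapCell_right hab h] at hv
          rcases h.eq_or_lt with rfl | h
          · rw [swapCell_right_le hab le_rfl]
            exact ⟨u₀, hu₀⟩
          · obtain ⟨m, rfl⟩ : ∃ k, m = k + 1 := ⟨m - 1, by omega⟩
            rw [swapCell_right hab (by omega)]
            exact hf.down _ _ _ hv
      · rw [swapCell_other hja hjb] at hv ⊢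
        exact hf.down _ _ _ hv
  · intro u v j m hu hv
    rw [swapCell_comp_eq_iff hab] at hu hv
    by_cases hja : j = a
    · subst hja
      rcases lt_or_ge m i with h | h
      · rw [swapCell_left_lt hab h] at hu
        rcases lt_or_ge (m + 1) i with h' | h'
        · rw [swapCell_left_lt hab h'] at hv
          exact hf.incr _ _ _ _ hu hv
        · obtain rfl : i = m + 1 := by omega
          rw [swapCell_left le_rfl] at hv
          obtain ⟨x, hx⟩ := hf.down_le h.le ⟨u₀, hu₀⟩
          obtain ⟨w, hw, hxw⟩ := exists_of_not_flawAt (hlow m h) hx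
          obtain rfl : w = u := hf.inj (hw.trans hu.symm)
          have h1 : x < u₀ := hf.incr _ _ _ _ hx hu₀
          have h2 : u₀ < v := hf.incr _ _ _ _ hu₀ hv
          have h4 : w ≠ v := by
            rintro rfl
            exact hxw (h1.trans h2)
          by_contra hwv
          -- The chain `x < u₀ < v` lies in column `b`. As `x < w` and `w < v` both fail, `w` is
          -- incomparable to all three.
          refine hP x u₀ v w h1 h2 ⟨⟨fun h => ?_, fun h => ?_⟩, ⟨fun h => ?_, fun h => ?_⟩,
            ⟨fun h => ?_, fun h => ?_⟩⟩
          · rcases h.eq_or_lt with rfl | h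
            · exact hab (congrArg Prod.fst (hu.symm.trans hx))
            · exact hxw h
          · exact hwv (h.trans_lt (h1.trans h2))
          · exact hxw (h1.trans_le h)
          · exact hwv (h.trans_lt h2)
          · exact hxw ((h1.trans h2).trans_le h)
          · exact hwv (lt_of_le_of_ne h h4)
      · rw [swapCell_left h] at hu
        rw [swapCell_left (by omega)] at hv
        exact hf.incr _ _ _ _ hu hv
    · by_cases hjb : j = b
      · subst hjb
        rcases lt_trichotomy m i with h | rfl | h
        · rw [swapCell_right_le hab (by omega)] at hu hv
          exact hf.incr _ _ _ _ hu hv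
        · rw [swapCell_right_le hab le_rfl] at hu
          rw [swapCell_right hab le_rfl] at hv
          obtain rfl : u₀ = u := hf.inj (hu₀.trans hu.symm)
          exact hflaw v hv
        · obtain ⟨m, rfl⟩ : ∃ k, m = k + 1 := ⟨m - 1, by omega⟩
          rw [swapCell_right hab (by omega)] at hu hv
          exact hf.incr _ _ _ _ hu hv
      · rw [swapCell_other hja hjb] at hu hv
        exact hf.incr _ _ _ _ hu hv

variable [Fintype P]

open Classical in
/-- The length of column `j` of an array. -/
def arrayColLen (f : P → C × ℕ) (j : C) : ℕ := (Finset.univ.filter fun v => (f v).1 = j).card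

theorem IsArray.exists_iff {f : P → C × ℕ} (hf : IsArray f) {j : C} {m : ℕ} :
    (∃ v, f v = (j, m)) ↔ m < arrayColLen f j := by
  classical
  set S := (Finset.univ.filter fun v => (f v).1 = j).image fun v => (f v).2 with hS
  have hcard : S.card = arrayColLen f j := by
    refine Finset.card_image_of_injOn fun u hu v hv h => hf.inj (Prod.ext ?_ h)
    simp only [Finset.coe_filter, Finset.mem_univ, true_and, Set.mem_ofPred_eq] at hu hv
    rw [hu, hv]
  have hmem : ∀ m, m ∈ S ↔ ∃ v, f v = (j, m) := by
    intro m
    simp [hS, Prod.ext_iff]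
  rw [← hmem, ← hcard]
  constructor
  · intro h
    have : Finset.range (m + 1) ⊆ S := fun k hk =>
      (hmem k).mpr (hf.down_le (Nat.lt_succ_iff.mp (Finset.mem_range.mp hk)) ((hmem m).mp h))
    simpa using Finset.card_le_card this
  · intro h
    by_contra hm
    have : S ⊆ Finset.range m := by
      intro k hk
      rw [Finset.mem_range]
      by_contra! hk'
      exact hm ((hmem m).mpr (hf.down_le hk' ((hmem k).mp hk)))
    have := Finset.card_le_card this
    rw [Finset.card_range] at this
    omega

theorem arrayColLen_le (f : P → C × ℕ) (j : C) : arrayColLen f j ≤ Fintype.card P :=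
  Finset.card_le_univ _

/-- For `b = a + 1` the new lengths amount to transposing the numbers `k_j - j` (read modulo `r` at
the wrap-around), which is why the determinant changes sign. -/
theorem IsArray.arrayColLen_swap (hP : ThreePlusOneFree P) {f : P → C × ℕ} (hf : IsArray f)
    {a b : C} {i : ℕ} (hlow : ∀ i' < i, ¬ FlawAt f a b i') (hi : FlawAt f a b i) :
    arrayColLen (swapCell a b i ∘ f) a + 1 = arrayColLen f b ∧
    arrayColLen (swapCell a b i ∘ f) b = arrayColLen f a + 1 ∧
    ∀ c, c ≠ a → c ≠ b → arrayColLen (swapCell a b i ∘ f) c = arrayColLen f c := by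
  have hf' := hf.swap hP hlow hi
  have hab := hi.ne
  obtain ⟨u₀, hu₀, -⟩ := hi
  have hib : i < arrayColLen f b := hf.exists_iff.mp ⟨u₀, hu₀⟩
  have hia : i ≤ arrayColLen f a := by
    rcases i with _ | i
    · omega
    · obtain ⟨u, hu⟩ := hf.down _ _ _ hu₀
      obtain ⟨w, hw, -⟩ := exists_of_not_flawAt (hlow i (by omega)) hu
      exact hf.exists_iff.mp ⟨w, hw⟩
  have key : ∀ c m, m < arrayColLen (swapCell a b i ∘ f) c ↔
      (swapCell a b i (c, m)).2 < arrayColLen f (swapCell a b i (c, m)).1 := by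
    intro c m
    rw [← hf'.exists_iff, ← hf.exists_iff]
    simp only [swapCell_comp_eq_iff hab]
  refine ⟨?_, ?_, fun c ha hb => ?_⟩
  · have h : ∀ m, m < arrayColLen (swapCell a b i ∘ f) a ↔ m + 1 < arrayColLen f b := by
      intro m
      rw [key]
      rcases lt_or_ge m i with h | h
      · rw [swapCell_left_lt hab h]
        simp only
        omega
      · rw [swapCell_left h]
    have h1 := h (arrayColLen (swapCell a b i ∘ f) a)
    have h2 := h (arrayColLen f b - 1)
    have h3 := h (arrayColLen f b - 2)
    omega
  · have h : ∀ m, m < arrayColLen (swapCell a b i ∘ f) b ↔ m < arrayColLen f a + 1 := by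
      intro m
      rw [key]
      rcases le_or_gt m i with h | h
      · rw [swapCell_right_le hab h]
        simp only
        omega
      · obtain ⟨m, rfl⟩ : ∃ k, m = k + 1 := ⟨m - 1, by omega⟩
        rw [swapCell_right hab (by omega)]
        simp only
        omega
    have h1 := h (arrayColLen (swapCell a b i ∘ f) b)
    have h2 := h (arrayColLen f a + 1)
    omega
  · have h : ∀ m, m < arrayColLen (swapCell a b i ∘ f) c ↔ m < arrayColLen f c := by
      intro m
      rw [key, swapCell_other ha hb]
    have h1 := h (arrayColLen (swapCell a b i ∘ f) c)
    have h2 := h (arrayColLen f c)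
    omega

end Arrays

/-! ### Proper colourings as arrays -/

section Colorings

variable {P C : Type*} [PartialOrder P] [Fintype P]

open Classical in
/-- The array whose columns are the colour classes of `κ`, each one sorted increasingly. -/
def sortArray (κ : P → C) (v : P) : C × ℕ :=
  (κ v, (Finset.univ.filter fun u => κ u = κ v ∧ u < v).card)

theorem isArray_sortArray {κ : P → C} (hκ : ∀ u v, (incGraph P).Adj u v → κ u ≠ κ v) :
    IsArray (sortArray κ) := by
  classical
  have hcomp : ∀ u v, κ u = κ v → u ≤ v ∨ v ≤ u := by
    intro u v h
    by_contra! h'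
    exact hκ u v h' h
  have hmono : ∀ u v, κ u = κ v → u < v → (sortArray κ u).2 < (sortArray κ v).2 := by
    intro u v h huv
    refine Finset.card_lt_card ((Finset.ssubset_iff_of_subset ?_).mpr ⟨u, ?_, ?_⟩)
    · intro x hx
      simp only [Finset.mem_filter, Finset.mem_univ, true_and] at hx ⊢
      exact ⟨hx.1.trans h, hx.2.trans huv⟩
    · simp [h, huv]
    · simp
  refine ⟨?_, ?_, ?_⟩
  · intro u v h
    have hc : κ u = κ v := congrArg Prod.fst h
    have h2 : (sortArray κ u).2 = (sortArray κ v).2 := congrArg Prod.snd h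
    rcases hcomp u v hc with h' | h' <;> rcases h'.eq_or_lt with h' | h'
    · exact h'
    · exact absurd h2 (hmono u v hc h').ne
    · exact h'.symm
    · exact absurd h2 (hmono v u hc.symm h').ne'
  · intro v j m hv
    obtain ⟨rfl, hm⟩ := Prod.ext_iff.mp hv
    simp only [sortArray] at hm
    -- Colour classes are chains, so a maximal element below `v` in its class is its immediate
    -- predecessor there.
    obtain ⟨u, hu⟩ := (Finset.univ.filter fun u => κ u = κ v ∧ u < v).exists_maximal
      (Finset.card_pos.mp (by omega))
    have hu1 := hu.1
    simp only [Finset.mem_filter, Finset.mem_univ, true_and] at hu1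
    refine ⟨u, Prod.ext hu1.1 ?_⟩
    have : (Finset.univ.filter fun x => κ x = κ u ∧ x < u) =
        (Finset.univ.filter fun u => κ u = κ v ∧ u < v).erase u := by
      ext x
      simp only [Finset.mem_filter, Finset.mem_univ, true_and, Finset.mem_erase]
      constructor
      · rintro ⟨h1, h2⟩
        exact ⟨h2.ne, h1.trans hu1.1, h2.trans hu1.2⟩
      · rintro ⟨h1, h2, h3⟩
        refine ⟨h2.trans hu1.1.symm, ?_⟩
        rcases hcomp x u (h2.trans hu1.1.symm) with h | h
        · exact lt_of_le_of_ne h h1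
        · exact lt_of_le_of_ne (hu.2 (by simp [h2, h3]) h) h1
    simp only [sortArray]
    rw [this, Finset.card_erase_of_mem hu.1, hm]
    rfl
  · intro u v j m hu hv
    obtain ⟨rfl, hm⟩ := Prod.ext_iff.mp hu
    obtain ⟨hc, hm'⟩ := Prod.ext_iff.mp hv
    have hc : κ v = κ u := hc
    simp only at hm hm'
    rcases hcomp u v hc.symm with h' | h' <;> rcases h'.eq_or_lt with h' | h'
    · subst h'; omega
    · exact h'
    · subst h'; omega
    · have := hmono v u hc h'
      omega

/-- Columns are increasing and have no gaps, so the row of `v` is the number of smaller elements in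
its column. -/
theorem IsArray.eq_sortArray {f : P → C × ℕ} (hf : IsArray f) :
    sortArray (fun v => (f v).1) = f := by
  classical
  funext v
  refine Prod.ext rfl ?_
  simp only [sortArray]
  have hlt : ∀ u, (f u).1 = (f v).1 → (u < v ↔ (f u).2 < (f v).2) := by
    intro u hu
    constructor
    · intro h
      by_contra! h'
      rcases h'.eq_or_lt with h' | h'
      · exact h.ne (hf.inj (Prod.ext hu h'.symm))
      · exact lt_asymm h (hf.lt_of_lt (j := (f v).1) h' rfl (Prod.ext hu rfl))
    · intro h
      exact hf.lt_of_lt (j := (f v).1) h (Prod.ext hu rfl) rfl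
  rw [← Finset.card_range (f v).2]
  refine Finset.card_bij (fun u _ => (f u).2) ?_ ?_ ?_
  · intro u hu
    simp only [Finset.mem_filter, Finset.mem_univ, true_and] at hu
    exact Finset.mem_range.mpr ((hlt u hu.1).mp hu.2)
  · intro u hu w hw h
    simp only [Finset.mem_filter, Finset.mem_univ, true_and] at hu hw
    exact hf.inj (Prod.ext (hu.1.trans hw.1.symm) h)
  · intro m hm
    rw [Finset.mem_range] at hm
    obtain ⟨u, hu⟩ := hf.down_le (j := (f v).1) hm.le ⟨v, rfl⟩
    have h1 : (f u).1 = (f v).1 := by rw [hu]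
    refine ⟨u, ?_, by rw [hu]⟩
    simp only [Finset.mem_filter, Finset.mem_univ, true_and]
    exact ⟨h1, (hlt u h1).mpr (by rw [hu]; exact hm)⟩

theorem IsArray.proper {f : P → C × ℕ} (hf : IsArray f) (u v : P)
    (h : (incGraph P).Adj u v) : (f u).1 ≠ (f v).1 := by
  intro hc
  obtain ⟨h1, h2⟩ : IncompRel (· ≤ ·) u v := h
  rcases lt_trichotomy (f u).2 (f v).2 with h | h | h
  · exact h1 (hf.lt_of_lt (j := (f v).1) h (Prod.ext hc rfl) rfl).le
  · exact h1 (hf.inj (Prod.ext hc h)).le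
  · exact h2 (hf.lt_of_lt (j := (f v).1) h rfl (Prod.ext hc rfl)).le

variable (P C) in
/-- The proper colourings of the incomparability graph, as functions. -/
abbrev ProperColoring : Type _ := {κ : P → C // ∀ u v, (incGraph P).Adj u v → κ u ≠ κ v}

variable (P C) in
/-- The type of `P`-arrays. -/
abbrev PArray : Type _ := {f : P → C × ℕ // IsArray f}

variable (P C) in
/-- Proper colourings correspond to arrays. -/
def coloringEquivArray : ProperColoring P C ≃ PArray P C where
  toFun κ := ⟨sortArray κ.1, isArray_sortArray κ.2⟩
  invFun f := ⟨fun v => (f.1 v).1, f.2.proper⟩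
  left_inv _ := rfl
  right_inv f := Subtype.ext f.2.eq_sortArray

/-- Permuting the colours of proper colourings. -/
def permColoring (σ : Equiv.Perm C) : ProperColoring P C ≃ ProperColoring P C where
  toFun κ := ⟨fun v => σ (κ.1 v), fun u v h => σ.injective.ne (κ.2 u v h)⟩
  invFun κ := ⟨fun v => σ.symm (κ.1 v), fun u v h => σ.symm.injective.ne (κ.2 u v h)⟩
  left_inv κ := by simp
  right_inv κ := by simp

theorem permColoring_apply (σ : Equiv.Perm C) (κ : ProperColoring P C) (v : P) :
    (permColoring σ κ).1 v = σ (κ.1 v) := rfl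

instance [Fintype C] : Fintype (ProperColoring P C) := Fintype.ofFinite _

instance [Fintype C] : Fintype (PArray P C) := Fintype.ofEquiv _ (coloringEquivArray P C)

end Colorings

/-! ### Cyclic sign-reversing cancellation -/

section Cancellation

variable {P : Type*} [PartialOrder P] [Fintype P] {r : ℕ} [NeZero r]

/-- `f` satisfies the cyclic row conditions in all rows above row `i`. -/
def NoFlawAbove (f : P → Fin r × ℕ) (i : ℕ) : Prop := ∀ i' < i, ∀ j, ¬ FlawAt f j (j + 1) i'

open Fin.CommRing in
theorem exists_mem_sub_one_notMem {t : Finset (Fin r)} (h0 : t.Nonempty) (h1 : t ≠ Finset.univ) :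
    ∃ j ∈ t, j - 1 ∉ t := by
  by_contra! h
  obtain ⟨a, ha⟩ := h0
  refine h1 (Finset.eq_univ_iff_forall.mpr fun b => ?_)
  have key : ∀ n : ℕ, a - (n : Fin r) ∈ t := by
    intro n
    induction n with
    | zero => simpa using ha
    | succ n ih =>
      have := h _ ih
      rwa [sub_sub, ← Nat.cast_succ] at this
  have := key (a - b).val
  rwa [Fin.cast_val_eq_self, sub_sub_cancel] at this

/-- If every position were flawed, each entry of the row would be greater than the next one
cyclically, and a finite set of entries has a minimal one. -/
theorem exists_not_flawAt (f : P → Fin r × ℕ) (i : ℕ) : ∃ j, ¬ FlawAt f j (j + 1) i := by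
  by_contra! h
  choose u hu hlt using h
  obtain ⟨x, ⟨j, rfl⟩, hx⟩ := (wellFounded_lt (α := P)).has_min (Set.range u) ⟨u 0, 0, rfl⟩
  refine hx (u (j + 1)) ⟨_, rfl⟩ ?_
  exact hlt (j + 1) (u j) (hu j)

/-- In row `i` the exchange changes only column `j`, which matters at positions `j` and `j - 1`. At
`j` the new left entry, if any, comes from just below the right entry, so the flaw persists.
Position `j - 1` is out of control and is excluded by `hne`. -/
theorem flawAt_swap {f : P → Fin r × ℕ} (hf : IsArray f) {j j' : Fin r} {i : ℕ} (hj : FlawAt f j (j + 1) i)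
    (hj' : FlawAt f j' (j' + 1) i) (hne : j' + 1 ≠ j) :
    FlawAt (swapCell j (j + 1) i ∘ f) j' (j' + 1) i := by
  have hab := hj.ne
  obtain ⟨u, hu, h⟩ := hj'
  by_cases hjj : j' = j
  · subst hjj
    refine ⟨u, ?_, fun v hv => ?_⟩
    · rw [swapCell_comp_eq_iff hab, swapCell_right_le hab le_rfl]
      exact hu
    · rw [swapCell_comp_eq_iff hab, swapCell_left le_rfl] at hv
      exact hf.incr _ _ _ _ hu hv
  · refine ⟨u, ?_, fun v hv => ?_⟩
    · rw [swapCell_comp_eq_iff hab, swapCell_other hne (by simpa using hjj)]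
      exact hu
    · rw [swapCell_comp_eq_iff hab] at hv
      by_cases h' : j' = j + 1
      · rw [h', swapCell_right_le hab le_rfl, ← h'] at hv
        exact h v hv
      · rw [swapCell_other hjj h'] at hv
        exact h v hv

theorem noFlawAbove_swap {f : P → Fin r × ℕ} {j : Fin r} {i : ℕ} (h : NoFlawAbove f i)
    (hj : FlawAt f j (j + 1) i) : NoFlawAbove (swapCell j (j + 1) i ∘ f) i := by
  have hab := hj.ne
  have hfix : ∀ c m, m < i → swapCell j (j + 1) i (c, m) = (c, m) := by
    intro c m hm
    by_cases h1 : c = j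
    · rw [h1, swapCell_left_lt hab hm]
    · by_cases h2 : c = j + 1
      · rw [h2, swapCell_right_le hab hm.le]
      · rw [swapCell_other h1 h2]
  rintro i' hi' j' ⟨u, hu, hlt⟩
  simp only [swapCell_comp_eq_iff hab, hfix _ _ hi'] at hu hlt
  exact h i' hi' j' ⟨u, hu, hlt⟩

/-- A weight on column lengths that changes sign under the exchanges of column tails. -/
def CyclicAlternating (W : (Fin r → ℕ) → ℂ) : Prop :=
  ∀ (k k' : Fin r → ℕ) (j : Fin r), j ≠ j + 1 → k' j + 1 = k (j + 1) → k' (j + 1) = k j + 1 →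
    (∀ c, c ≠ j → c ≠ j + 1 → k' c = k c) → W k' = - W k

open Classical in
-- The condition asks for flaws at least on `t`, not exactly on `t`. The exchange may create or
-- destroy a flaw at `j - 1`, so only the weaker condition is stable.
theorem sum_flawed_eq_zero (hP : ThreePlusOneFree P) {W : (Fin r → ℕ) → ℂ}
    (hW : CyclicAlternating W) (i : ℕ) {t : Finset (Fin r)} (ht : t.Nonempty) :
    ∑ f : PArray P (Fin r) with NoFlawAbove f.1 i ∧ ∀ j ∈ t, FlawAt f.1 j (j + 1) i,
      W (arrayColLen f.1) = 0 := by
  by_cases htu : t = Finset.univ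
  · refine Finset.sum_eq_zero fun f hf => ?_
    simp only [Finset.mem_filter, Finset.mem_univ, true_and, htu] at hf
    obtain ⟨j, hj⟩ := exists_not_flawAt f.1 i
    exact absurd (hf.2 j trivial) hj
  obtain ⟨j, hjt, hj1⟩ := exists_mem_sub_one_notMem ht htu
  have hmem : ∀ f ∈ Finset.univ.filter (fun f : PArray P (Fin r) =>
      NoFlawAbove f.1 i ∧ ∀ j ∈ t, FlawAt f.1 j (j + 1) i),
      NoFlawAbove f.1 i ∧ (∀ j ∈ t, FlawAt f.1 j (j + 1) i) ∧ FlawAt f.1 j (j + 1) i := by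
    intro f hf
    simp only [Finset.mem_filter, Finset.mem_univ, true_and] at hf
    exact ⟨hf.1, hf.2, hf.2 j hjt⟩
  refine Finset.sum_involution
    (fun f hf => ⟨swapCell j (j + 1) i ∘ f.1,
      f.2.swap hP (fun i' hi' => (hmem f hf).1 i' hi' j) (hmem f hf).2.2⟩) ?_ ?_ ?_ ?_
  · intro f hf
    obtain ⟨h1, -, h3⟩ := hmem f hf
    obtain ⟨ha, hb, hc⟩ := f.2.arrayColLen_swap hP (fun i' hi' => h1 i' hi' j) h3
    rw [hW _ _ j h3.ne ha hb hc, add_neg_cancel]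
  · intro f hf hne heq
    obtain ⟨h1, -, h3⟩ := hmem f hf
    obtain ⟨ha, hb, hc⟩ := f.2.arrayColLen_swap hP (fun i' hi' => h1 i' hi' j) h3
    -- A fixed array satisfies `W = -W`, so its weight is zero.
    have heq' : swapCell j (j + 1) i ∘ f.1 = f.1 := congrArg Subtype.val heq
    rw [heq'] at ha hb
    exact hne (self_eq_neg.mp (hW _ _ j h3.ne ha hb fun _ _ _ => rfl))
  · intro f hf
    obtain ⟨h1, h2, h3⟩ := hmem f hf
    simp only [Finset.mem_filter, Finset.mem_univ, true_and]
    refine ⟨noFlawAbove_swap h1 h3, fun j' hj' => flawAt_swap f.2 h3 (h2 j' hj') ?_⟩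
    rintro rfl
    exact hj1 (by simpa using hj')
  · intro f hf
    refine Subtype.ext ?_
    simp only
    rw [← Function.comp_assoc, (swapCell_involutive (hmem f hf).2.2.ne i).comp_self,
      Function.id_comp]

open Classical in
-- Inclusion-exclusion over the sets of flawed positions in row `i`: every nonempty set contributes
-- zero, so requiring row `i` to be free of flaws does not change the sum.
theorem sum_noFlawAbove_succ (hP : ThreePlusOneFree P) {W : (Fin r → ℕ) → ℂ}
    (hW : CyclicAlternating W) (i : ℕ) :
    ∑ f : PArray P (Fin r) with NoFlawAbove f.1 (i + 1), W (arrayColLen f.1) =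
      ∑ f : PArray P (Fin r) with NoFlawAbove f.1 i, W (arrayColLen f.1) := by
  have h := Finset.inclusion_exclusion_sum_inf_compl Finset.univ
    (fun j : Fin r => Finset.univ.filter fun f : PArray P (Fin r) => FlawAt f.1 j (j + 1) i)
    (fun f => if NoFlawAbove f.1 i then W (arrayColLen f.1) else 0)
  rw [Finset.sum_eq_single (s := Finset.univ.powerset) ∅] at h
  · rw [← Finset.sum_filter, Finset.card_empty, Finset.inf_empty, pow_zero, one_smul,
      Finset.top_eq_univ, ← Finset.sum_filter] at h
    rw [← h]
    refine Finset.sum_congr ?_ fun _ _ => rfl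
    ext f
    simp only [Finset.mem_filter, Finset.mem_univ, true_and, Finset.mem_inf, Finset.mem_compl,
      true_implies]
    constructor
    · intro h
      exact ⟨fun j => h i (by omega) j, fun i' hi' => h i' (by omega)⟩
    · rintro ⟨h1, h2⟩ i' hi'
      rcases (Nat.lt_succ_iff.mp hi').eq_or_lt with rfl | hlt
      · exact h1
      · exact h2 i' hlt
  · intro t _ ht
    rw [← Finset.sum_filter]
    refine (congrArg _ ?_).trans (smul_zero _)
    rw [← sum_flawed_eq_zero hP hW i (Finset.nonempty_iff_ne_empty.mpr ht)]
    refine Finset.sum_congr ?_ fun _ _ => rfl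
    ext f
    simp [Finset.mem_inf, and_comm]
  · simp

open Classical in
/-- The alternating sum over all arrays is the sum over the arrays that satisfy all cyclic row
conditions. -/
theorem sum_array_eq (hP : ThreePlusOneFree P) {W : (Fin r → ℕ) → ℂ}
    (hW : CyclicAlternating W) :
    ∑ f : PArray P (Fin r), W (arrayColLen f.1) =
      ∑ f : PArray P (Fin r) with ∀ i j, ¬ FlawAt f.1 j (j + 1) i, W (arrayColLen f.1) := by
  have h : ∀ i, ∑ f : PArray P (Fin r) with NoFlawAbove f.1 i, W (arrayColLen f.1) =
      ∑ f : PArray P (Fin r), W (arrayColLen f.1) := by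
    intro i
    induction i with
    | zero =>
      refine Finset.sum_congr ?_ fun _ _ => rfl
      simp [NoFlawAbove]
    | succ i ih => rw [sum_noFlawAbove_succ hP hW, ih]
  -- A flaw needs an occupied box in its row, and no column is longer than `|P|`, so this bound
  -- covers all rows.
  rw [← h (Fintype.card P + 1)]
  refine Finset.sum_congr ?_ fun _ _ => rfl
  ext f
  simp only [Finset.mem_filter, Finset.mem_univ, true_and]
  refine ⟨fun h i j hflaw => ?_, fun h i _ j => h i j⟩
  refine h i ?_ j hflaw
  obtain ⟨u, hu, -⟩ := hflaw
  have := f.2.exists_iff.mp ⟨u, hu⟩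
  have := arrayColLen_le f.1 (j + 1)
  omega

end Cancellation

/-! ### The determinant at roots of unity -/

section Determinant

variable {r : ℕ} [NeZero r]

/-- The matrix `(z_i ^ (k_j - j))`. -/
def powMatrix (z : Fin r → ℂ) (k : Fin r → ℕ) : Matrix (Fin r) (Fin r) ℂ :=
  Matrix.of fun i j => z i ^ ((k j : ℤ) - (j : ℕ))

/-- This is where roots of unity are needed: at the wrap-around, `j + 1` in `Fin r` differs from the
integer `j + 1` by `r`. -/
theorem zpow_sub_succ {x : ℂ} (hx : x ^ r = 1) (n : ℤ) (j : Fin r) :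
    x ^ (n - ((j + 1 : Fin r) : ℕ)) = x ^ (n - (j : ℕ) - 1) := by
  have hx0 : x ≠ 0 := by
    rintro rfl
    rw [zero_pow (NeZero.ne r)] at hx
    exact zero_ne_one hx
  have hval : (((j + 1 : Fin r) : ℕ) : ℤ) = (j : ℕ) + 1 ∨
      (((j + 1 : Fin r) : ℕ) : ℤ) = (j : ℕ) + 1 - r := by
    obtain ⟨s, rfl⟩ := Nat.exists_eq_succ_of_ne_zero (NeZero.ne r)
    have h := Fin.val_add_one j
    split_ifs at h with hj
    · right
      rw [h, hj, Fin.val_last]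
      push_cast
      ring
    · left
      rw [h]
      push_cast
      ring
  rcases hval with h | h
  · rw [h, sub_sub]
  · rw [h, show n - ((j : ℕ) + 1 - (r : ℤ)) = (n - (j : ℕ) - 1) + (r : ℤ) by ring,
      zpow_add₀ hx0, zpow_natCast, hx, mul_one]

theorem cyclicAlternating_det {z : Fin r → ℂ} (hz : ∀ i, z i ^ r = 1) :
    CyclicAlternating fun k => (powMatrix z k).det := by
  intro k k' j hj ha hb hc
  have : powMatrix z k' = (powMatrix z k).submatrix id (Equiv.swap j (j + 1)) := by
    ext i c
    simp only [powMatrix, Matrix.of_apply, Matrix.submatrix_apply, id]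
    by_cases h1 : c = j
    · subst h1
      rw [Equiv.swap_apply_left, zpow_sub_succ (hz i), ← ha]
      congr 1
      push_cast
      ring
    · by_cases h2 : c = j + 1
      · subst h2
        rw [Equiv.swap_apply_right, zpow_sub_succ (hz i), hb]
        congr 1
        push_cast
        ring
      · rw [Equiv.swap_apply_of_ne_of_ne h1 h2, hc c h1 h2]
  simp only [this, Matrix.det_permute', Equiv.Perm.sign_swap hj]
  simp

theorem det_powMatrix_zero_ne_zero {z : Fin r → ℂ} (hz : Function.Injective z) :
    (powMatrix z 0).det ≠ 0 := by
  have : powMatrix z 0 = Matrix.vandermonde fun i => (z i)⁻¹ := by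
    ext i j
    simp [powMatrix, Matrix.vandermonde_apply]
  rw [this, Matrix.det_vandermonde_ne_zero_iff]
  exact inv_injective.comp hz

theorem det_powMatrix_const {z : Fin r → ℂ} (hz : ∀ i, z i ≠ 0) (c : ℕ) :
    (powMatrix z fun _ => c).det = (∏ i, z i) ^ c * (powMatrix z 0).det := by
  have : powMatrix z (fun _ => c) = Matrix.of fun i j => z i ^ c * powMatrix z 0 i j := by
    ext i j
    simp only [powMatrix, Matrix.of_apply, Pi.zero_apply]
    rw [← zpow_natCast, ← zpow_add₀ (hz i)]
    congr 1
    push_cast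
    ring
  rw [this, Matrix.det_mul_column, Finset.prod_pow]

variable {P : Type*} [PartialOrder P] [Fintype P]

/-- Multiplying the sum over colourings by the Vandermonde-like determinant. -/
theorem sum_coloring_mul_det {z : Fin r → ℂ} (hz : ∀ i, z i ≠ 0) :
    (∑ κ : ProperColoring P (Fin r), ∏ v, z (κ.1 v)) * (powMatrix z 0).det =
      ∑ f : PArray P (Fin r), (powMatrix z (arrayColLen f.1)).det := by
  classical
  have hsym : ∀ σ : Equiv.Perm (Fin r), ∑ κ : ProperColoring P (Fin r), ∏ v, z (σ (κ.1 v)) =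
      ∑ κ : ProperColoring P (Fin r), ∏ v, z (κ.1 v) := by
    intro σ
    exact Fintype.sum_equiv (permColoring σ) _ _ fun κ => rfl
  have hprod : ∀ (σ : Equiv.Perm (Fin r)) (f : PArray P (Fin r)),
      ∏ v, z (σ (f.1 v).1) = ∏ j, z (σ j) ^ arrayColLen f.1 j := by
    intro σ f
    rw [← Finset.prod_fiberwise_of_maps_to (s := Finset.univ) (t := Finset.univ)
      (g := fun v => (f.1 v).1) (fun _ _ => Finset.mem_univ _)]
    refine Finset.prod_congr rfl fun j _ => ?_
    rw [Finset.prod_congr rfl (g := fun _ => z (σ j)), Finset.prod_const]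
    · unfold arrayColLen
      congr!
    · intro v hv
      simp only [Finset.mem_filter, Finset.mem_univ, true_and] at hv
      rw [hv]
  have harr : ∀ σ : Equiv.Perm (Fin r), ∑ κ : ProperColoring P (Fin r), ∏ v, z (σ (κ.1 v)) =
      ∑ f : PArray P (Fin r), ∏ j, z (σ j) ^ arrayColLen f.1 j := by
    intro σ
    exact Fintype.sum_equiv (coloringEquivArray P (Fin r)) _ _ fun κ =>
      hprod σ (coloringEquivArray P (Fin r) κ)
  simp only [Matrix.det_apply]
  rw [Finset.sum_comm, Finset.mul_sum]
  refine Finset.sum_congr rfl fun σ _ => ?_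
  -- In the `σ`-term of the determinant, the symmetric sum over colourings is rewritten with its
  -- colours permuted by the same `σ`, so that the exponents of each `z (σ j)` add up.
  rw [← Finset.smul_sum, mul_smul_comm, ← hsym σ, harr, Finset.sum_mul]
  refine congrArg _ (Finset.sum_congr rfl fun f _ => ?_)
  rw [← Finset.prod_mul_distrib]
  refine Finset.prod_congr rfl fun j _ => ?_
  simp only [powMatrix, Matrix.of_apply, Pi.zero_apply]
  rw [← zpow_natCast, ← zpow_add₀ (hz _)]
  congr 1
  push_cast
  ring

end Determinant

/-! ### Cylindric tableaux of rectangular shape -/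

section Rectangles

theorem mem_rect_sdiff_bot {r c : ℕ} {x : ℕ × ℕ} :
    x ∈ (rectShape r c).outer.cells \ (rectShape r c).inner.cells ↔ x.1 < c ∧ x.2 < r := by
  simp [rectShape, rect]

/-- The boxes of a rectangle are the pairs of a row and a column. -/
def rectCellEquiv (r c : ℕ) :
    SkewCell (rectShape r c).outer (rectShape r c).inner ≃ Fin c × Fin r where
  toFun x := (⟨x.1.1, (mem_rect_sdiff_bot.mp x.2).1⟩, ⟨x.1.2, (mem_rect_sdiff_bot.mp x.2).2⟩)
  invFun y := ⟨(y.1, y.2), mem_rect_sdiff_bot.mpr ⟨y.1.2, y.2.2⟩⟩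
  left_inv _ := rfl
  right_inv _ := rfl

theorem colLen_rect {r c j : ℕ} (hj : j < r) : (rect r c).colLen j = c := by
  refine eq_of_forall_lt_iff fun i => ?_
  rw [← YoungDiagram.mem_iff_lt_colLen, mem_rect]
  exact and_iff_left hj

theorem rowLen_rect {r c i : ℕ} (hi : i < c) : (rect r c).rowLen i = r := by
  refine eq_of_forall_lt_iff fun j => ?_
  rw [← YoungDiagram.mem_iff_lt_rowLen, mem_rect]
  exact and_iff_right hi

theorem colLen_bot (j : ℕ) : (⊥ : YoungDiagram).colLen j = 0 := by
  refine eq_of_forall_lt_iff fun i => ?_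
  rw [← YoungDiagram.mem_iff_lt_colLen]
  simp

variable {r c : ℕ} [NeZero r]

theorem mem_glued_rect {i j : ℕ} :
    (i, j) ∈ (rectShape r c).gluedOuter.cells \ (rectShape r c).gluedInner.cells ↔
      i < c ∧ j ≤ r := by
  rw [Finset.mem_sdiff, CylindricShape.gluedOuter, CylindricShape.gluedInner, mem_glueDiagram,
    mem_glueDiagram]
  simp only [rectShape, colLen_bot, add_zero, not_lt_zero, and_false, or_self, not_false_eq_true,
    and_true, colLen_rect (Nat.pos_of_ne_zero (NeZero.ne r))]
  rcases Nat.eq_zero_or_pos c with rfl | hc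
  · have : ∀ j, (rect r 0).colLen j = 0 := by
      intro j
      refine eq_of_forall_lt_iff fun i => ?_
      rw [← YoungDiagram.mem_iff_lt_colLen, mem_rect]
      simp
    simp [this]
  · rw [rowLen_rect hc]
    constructor
    · rintro (⟨h1, h2⟩ | ⟨rfl, h2⟩)
      · exact ⟨by rwa [colLen_rect h1] at h2, h1.le⟩
      · exact ⟨h2, le_rfl⟩
    · rintro ⟨h1, h2⟩
      rcases h2.lt_or_eq with h2 | rfl
      · exact Or.inl ⟨h2, by rwa [colLen_rect h2]⟩
      · exact Or.inr ⟨rfl, h1⟩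

/-- The set where `g` attains its maximum is closed under cyclic predecessor, hence is everything.
-/
theorem eq_of_forall_add_one_le {α : Type*} [LinearOrder α] {g : Fin r → α}
    (h : ∀ j, g (j + 1) ≤ g j) (j j' : Fin r) : g j = g j' := by
  classical
  obtain ⟨j₀, hj₀⟩ := Finite.exists_max g
  have huniv : (Finset.univ.filter fun j => g j = g j₀) = Finset.univ := by
    by_contra hne
    obtain ⟨j, hj, hj'⟩ := exists_mem_sub_one_notMem ⟨j₀, by simp⟩ hne
    simp only [Finset.mem_filter, Finset.mem_univ, true_and] at hj hj'
    have := h (j - 1)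
    rw [sub_add_cancel, hj] at this
    exact hj' ((hj₀ _).antisymm this)
  have hall : ∀ j, g j = g j₀ := fun j => by simpa using huniv.ge (Finset.mem_univ j)
  rw [hall, hall j']

variable {P : Type*}

theorem glue_rect (T : SkewCell (rectShape r c).outer (rectShape r c).inner → P) {i j : ℕ}
    (h : (i, j) ∈ (rectShape r c).gluedOuter.cells \ (rectShape r c).gluedInner.cells) :
    (rectShape r c).glue T ⟨(i, j), h⟩ = T ((rectCellEquiv r c).symm
      (⟨i, (mem_glued_rect.mp h).1⟩, if hj : j < r then ⟨j, hj⟩ else 0)) := by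
  have hL : (rectShape r c).outer.rowLen 0 = r :=
    rowLen_rect (Nat.zero_lt_of_lt (mem_glued_rect.mp h).1)
  refine congrArg T (Subtype.ext ?_)
  simp only [CylindricShape.unglue, rectCellEquiv, Equiv.coe_fn_symm_mk, hL]
  split_ifs <;> simp [rectShape]

variable [PartialOrder P]

theorem isCylindricPTableau_rect_iff
    (T : SkewCell (rectShape r c).outer (rectShape r c).inner → P) :
    IsCylindricPTableau (rectShape r c) T ↔
      (∀ (i i' : Fin c) (j : Fin r), (i' : ℕ) = i + 1 →
        T ((rectCellEquiv r c).symm (i, j)) < T ((rectCellEquiv r c).symm (i', j))) ∧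
      ∀ (i : Fin c) (j : Fin r), ¬ T ((rectCellEquiv r c).symm (i, j + 1)) <
        T ((rectCellEquiv r c).symm (i, j)) := by
  have hsucc : ∀ j : Fin r, (if hj : (j : ℕ) + 1 < r then ⟨(j : ℕ) + 1, hj⟩ else 0) = j + 1 := by
    intro j
    obtain ⟨s, rfl⟩ := Nat.exists_eq_succ_of_ne_zero (NeZero.ne r)
    refine Fin.ext ?_
    rw [Fin.val_add_one j]
    rcases eq_or_ne j (Fin.last s) with rfl | h
    · simp
    · have : (j : ℕ) ≠ s := fun h' => h (Fin.ext h')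
      have := j.2
      rw [if_neg h, dif_pos (by omega)]
  simp only [IsCylindricPTableau, IsPTableau, glue_rect]
  constructor
  · rintro ⟨h1, h2⟩
    refine ⟨fun i i' j hi => ?_, fun i j => ?_⟩
    · have := h1 i j (mem_glued_rect.mpr ⟨i.2, j.2.le⟩)
        (mem_glued_rect.mpr ⟨hi ▸ i'.2, j.2.le⟩)
      simp only [j.2, dif_pos] at this
      convert this
    · have := h2 i j (mem_glued_rect.mpr ⟨i.2, j.2.le⟩)
        (mem_glued_rect.mpr ⟨i.2, j.2⟩)
      rw [hsucc] at this
      simpa only [j.2, dif_pos] using this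
  · rintro ⟨h1, h2⟩
    refine ⟨fun i j h h' => h1 _ _ _ rfl, fun i j h h' => ?_⟩
    have hj : j < r := (mem_glued_rect.mp h').2
    have := h2 ⟨i, (mem_glued_rect.mp h).1⟩ ⟨j, hj⟩
    rw [← hsucc] at this
    simpa only [hj, dif_pos] using this

end Rectangles

/-! ### Flawless arrays as standard cylindric tableaux -/

section Tableaux

variable {P : Type*} [PartialOrder P] [Fintype P] {r c : ℕ} [NeZero r]

/-- A box of column `j + 1` with no left neighbour counts as a flaw, so the lengths decrease weakly
around the cycle and must all agree. -/
theorem arrayColLen_of_no_flaw (hcard : Fintype.card P = r * c) {f : P → Fin r × ℕ}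
    (hf : IsArray f) (h : ∀ i j, ¬ FlawAt f j (j + 1) i) : arrayColLen f = fun _ => c := by
  classical
  have hle : ∀ j, arrayColLen f (j + 1) ≤ arrayColLen f j := by
    intro j
    refine le_of_forall_lt fun m hm => ?_
    obtain ⟨u, hu⟩ := hf.exists_iff.mpr hm
    obtain ⟨v, hv, -⟩ := exists_of_not_flawAt (h m j) hu
    exact hf.exists_iff.mp ⟨v, hv⟩
  have hall := eq_of_forall_add_one_le hle
  have hsum : Fintype.card P = ∑ j, arrayColLen f j := by
    rw [← Finset.card_univ, Finset.card_eq_sum_card_fiberwise (f := fun v => (f v).1)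
      (t := Finset.univ) (fun _ _ => Finset.mem_univ _)]
    unfold arrayColLen
    congr!
  simp only [fun j => hall j 0, Finset.sum_const, Finset.card_univ, Fintype.card_fin, smul_eq_mul] at hsum
  funext j
  rw [hall j 0]
  exact Nat.eq_of_mul_eq_mul_left (Nat.pos_of_ne_zero (NeZero.ne r)) (hsum.symm.trans hcard)

variable (P r c) in
/-- The standard cylindric tableaux of rectangular shape correspond to the arrays that satisfy
all cyclic row conditions. -/
theorem card_standardCylindricPTableau_rect (hcard : Fintype.card P = r * c) :
    Nat.card (StandardCylindricPTableau P (rectShape r c)) =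
      Nat.card {f : PArray P (Fin r) // ∀ i j, ¬ FlawAt f.1 j (j + 1) i} := by
  have hbij : ∀ T : StandardCylindricPTableau P (rectShape r c), Function.Bijective T.1 :=
    fun T => (Function.bijective_iff_existsUnique _).mpr T.2.2
  let F : StandardCylindricPTableau P (rectShape r c) → P → Fin r × ℕ := fun T p =>
    let x := rectCellEquiv r c ((Equiv.ofBijective _ (hbij T)).symm p)
    (x.2, x.1)
  have hF : ∀ T p (i : Fin c) (j : Fin r),
      F T p = (j, (i : ℕ)) ↔ p = T.1 ((rectCellEquiv r c).symm (i, j)) := by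
    intro T p i j
    rw [← Equiv.ofBijective_apply _ (hbij T), ← Equiv.symm_apply_eq, Equiv.eq_symm_apply,
      Prod.ext_iff, Prod.ext_iff, Fin.ext_iff (b := i)]
    exact and_comm
  have hFlt : ∀ T p j m, F T p = (j, m) → m < c := by
    intro T p j m h
    have h2 : (F T p).2 = m := congrArg Prod.snd h
    rw [← h2]
    exact Fin.is_lt _
  refine Nat.card_congr (Equiv.ofBijective (fun T => ⟨⟨F T, ?_, ?_, ?_⟩, ?_⟩) ⟨?_, ?_⟩)
  · intro u v h
    simp only [F, Prod.mk.injEq] at h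
    exact (Equiv.ofBijective _ (hbij T)).symm.injective
      ((rectCellEquiv r c).injective (Prod.ext (Fin.ext h.2) h.1))
  · intro v j m hv
    have hm := hFlt T v j _ hv
    exact ⟨T.1 ((rectCellEquiv r c).symm (⟨m, by omega⟩, j)), (hF T _ ⟨m, by omega⟩ j).mpr rfl⟩
  · intro u v j m hu hv
    have hm := hFlt T v j _ hv
    rw [(hF T u ⟨m, by omega⟩ j).mp hu, (hF T v ⟨m + 1, hm⟩ j).mp hv]
    exact ((isCylindricPTableau_rect_iff _).mp T.2.1).1 _ _ _ rfl
  · rintro i j ⟨u, hu, h⟩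
    have hi := hFlt T u _ _ hu
    have h1 := h _ ((hF T _ ⟨i, hi⟩ j).mpr rfl)
    rw [(hF T u ⟨i, hi⟩ _).mp hu] at h1
    exact ((isCylindricPTableau_rect_iff _).mp T.2.1).2 _ _ h1
  · intro T T' h
    have h' : F T = F T' := congrArg (fun x => x.1.1) h
    refine Subtype.ext (funext fun b => ?_)
    obtain ⟨⟨i, j⟩, rfl⟩ := (rectCellEquiv r c).symm.surjective b
    rw [← hF, ← h', hF]
  · rintro ⟨⟨f, hf⟩, hflaw⟩
    have hlen := arrayColLen_of_no_flaw hcard hf hflaw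
    have hex : ∀ (i : Fin c) (j : Fin r), ∃ v, f v = (j, (i : ℕ)) := fun i j =>
      hf.exists_iff.mpr (by rw [hlen]; exact i.2)
    choose t ht using hex
    have ht' : ∀ p, ∃ i j, t i j = p := by
      intro p
      have : (f p).2 < c := by
        have := hf.exists_iff.mp ⟨p, rfl⟩
        rwa [hlen] at this
      exact ⟨⟨_, this⟩, (f p).1, hf.inj (ht _ _)⟩
    refine ⟨⟨fun b => t (rectCellEquiv r c b).1 (rectCellEquiv r c b).2, ?_, fun p => ?_⟩, ?_⟩
    · rw [isCylindricPTableau_rect_iff]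
      simp only [Equiv.apply_symm_apply]
      refine ⟨fun i i' j hi => hf.incr _ _ j i (ht _ _) (by rw [ht, hi]), fun i j hlt => ?_⟩
      refine hflaw i j ⟨_, ht i (j + 1), fun v hv => ?_⟩
      rwa [hf.inj (hv.trans (ht i j).symm)]
    · obtain ⟨i, j, rfl⟩ := ht' p
      refine ⟨(rectCellEquiv r c).symm (i, j), by simp, fun b hb => ?_⟩
      rw [Equiv.eq_symm_apply]
      have := congrArg f hb
      simp only [ht, Prod.mk.injEq] at this
      exact Prod.ext (Fin.ext this.2) this.1
    · refine Subtype.ext (Subtype.ext (funext fun p => ?_))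
      obtain ⟨i, j, rfl⟩ := ht' p
      refine Eq.trans ((hF _ _ i j).mpr ?_) (ht i j).symm
      simp

/-- The sum over proper colourings of the products of `r`-th roots of unity counts standard
cylindric tableaux. -/
theorem sum_coloring_eq_card_tableaux (hP : ThreePlusOneFree P) (hcard : Fintype.card P = r * c)
    {z : Fin r → ℂ} (hinj : Function.Injective z) (hz : ∀ i, z i ^ r = 1) :
    ∑ κ : ProperColoring P (Fin r), ∏ v, z (κ.1 v) =
      Nat.card (StandardCylindricPTableau P (rectShape r c)) * (∏ i, z i) ^ c := by
  classical
  have hz0 : ∀ i, z i ≠ 0 := by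
    intro i h
    have := hz i
    rw [h, zero_pow (NeZero.ne r)] at this
    exact zero_ne_one this
  refine mul_right_cancel₀ (det_powMatrix_zero_ne_zero hinj) ?_
  rw [sum_coloring_mul_det hz0, sum_array_eq hP (cyclicAlternating_det hz),
    card_standardCylindricPTableau_rect P r c hcard, mul_assoc, ← det_powMatrix_const hz0,
    Nat.card_eq_fintype_card, Fintype.card_subtype, ← nsmul_eq_mul]
  refine Finset.sum_eq_card_nsmul fun f hf => ?_
  rw [arrayColLen_of_no_flaw hcard f.2 (Finset.mem_filter.mp hf).2]

end Tableaux

/-! ### Truncation to finitely many variables -/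

section Restriction

open MvPolynomial

/-- Setting all variables except the first `N` to zero. -/
def restrictVars (N : ℕ) : MvPowerSeries ℕ ℤ →ₐ[ℤ] MvPowerSeries (Fin N) ℤ :=
  MvPowerSeries.killCompl Fin.valEmbedding

theorem coeff_restrictVars {N : ℕ} (f : MvPowerSeries ℕ ℤ) (m : Fin N →₀ ℕ) :
    MvPowerSeries.coeff m (restrictVars N f) =
      MvPowerSeries.coeff (m.embDomain Fin.valEmbedding) f :=
  MvPowerSeries.coeff_killCompl f m

open Classical in
theorem coeff_elemSymm (k : ℕ) (m : ℕ →₀ ℕ) : MvPowerSeries.coeff m (elemSymm k) =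
    if (∀ i, m i ≤ 1) ∧ m.support.card = k then 1 else 0 := rfl

theorem sum_single_apply {ι : Type*} [DecidableEq ι] (t : Finset ι) (j : ι) :
    (∑ i ∈ t, Finsupp.single i 1 : ι →₀ ℕ) j = if j ∈ t then 1 else 0 := by
  simp [Finsupp.finsetSum_apply, Finsupp.single_apply]

theorem sum_single_eq_iff {ι : Type*} [DecidableEq ι] {t : Finset ι} {m : ι →₀ ℕ} :
    ∑ i ∈ t, Finsupp.single i 1 = m ↔ (∀ i, m i ≤ 1) ∧ m.support = t := by
  constructor
  · rintro rfl
    refine ⟨fun i => by rw [sum_single_apply]; split_ifs <;> simp, ?_⟩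
    ext j
    rw [Finsupp.mem_support_iff, sum_single_apply]
    simp
  · rintro ⟨h1, rfl⟩
    ext j
    rw [sum_single_apply]
    have := h1 j
    split_ifs with hj
    · have := Finsupp.mem_support_iff.mp hj
      omega
    · exact (Finsupp.notMem_support_iff.mp hj).symm

theorem restrictVars_elemSymm (N k : ℕ) :
    restrictVars N (elemSymm k) = (esymm (Fin N) ℤ k : MvPowerSeries (Fin N) ℤ) := by
  classical
  ext m
  rw [coeff_restrictVars, coeff_elemSymm, MvPolynomial.coeff_coe, esymm_eq_sum_monomial,
    coeff_sum]
  simp only [coeff_monomial, sum_single_eq_iff, Finsupp.support_embDomain, Finset.card_map]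
  have hiff : (∀ i, (m.embDomain Fin.valEmbedding) i ≤ 1) ↔ ∀ i, m i ≤ 1 := by
    constructor
    · intro h i
      have := h (Fin.valEmbedding i)
      rwa [Finsupp.embDomain_apply_self] at this
    · intro h i
      by_cases hi : i ∈ Set.range (Fin.valEmbedding (n := N))
      · obtain ⟨j, rfl⟩ := hi
        rw [Finsupp.embDomain_apply_self]
        exact h j
      · rw [Finsupp.embDomain_of_notMem_range _ _ _ hi]
        exact zero_le_one
  rw [hiff]
  by_cases h : ∀ i, m i ≤ 1
  · simp [h, Finset.mem_powersetCard]
  · simp [h]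

theorem restrictVars_elemSymmPart (N : ℕ) (lam : YoungDiagram) :
    restrictVars N (elemSymmPart lam) =
      ((lam.rowLens.map (esymm (Fin N) ℤ)).prod : MvPolynomial (Fin N) ℤ) := by
  rw [elemSymmPart, map_list_prod, List.map_map, ← coeToMvPowerSeries.ringHom_apply,
    map_list_prod, List.map_map]
  congr 1
  refine List.map_congr_left fun k _ => ?_
  simp only [Function.comp_apply, restrictVars_elemSymm, coeToMvPowerSeries.ringHom_apply]

theorem weight_comp {B : Type*} [Fintype B] (f : B → ℕ) (g : ℕ → ℕ) :
    weight (g ∘ f) = (weight f).mapDomain g := by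
  simp [weight, Finsupp.mapDomain_finsetSum, Finsupp.mapDomain_single]

theorem mem_support_weight {B : Type*} [Fintype B] {f : B → ℕ} {i : ℕ} :
    i ∈ (weight f).support ↔ ∃ b, f b = i := by
  classical
  simp [weight, Finsupp.finsetSum_apply, Finsupp.single_apply]

theorem degree_weight {B : Type*} [Fintype B] (f : B → ℕ) :
    (weight f).degree = Fintype.card B := by
  simp [weight]

variable (P : Type*) [PartialOrder P] [Fintype P]

/-- The chromatic symmetric polynomial in `N` variables. -/
def chromaticPoly (N : ℕ) : MvPolynomial (Fin N) ℤ :=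
  ∑ κ : ProperColoring P (Fin N), ∏ v, X (κ.1 v)

theorem chromaticPoly_isSymmetric (N : ℕ) : (chromaticPoly P N).IsSymmetric := by
  intro σ
  simp only [chromaticPoly, map_sum, map_prod, rename_X]
  exact Fintype.sum_equiv (permColoring σ) _ _ fun κ => by simp only [permColoring_apply]

theorem restrictVars_chromaticSymm (N : ℕ) :
    restrictVars N (chromaticSymm (incGraph P)) =
      (chromaticPoly P N : MvPowerSeries (Fin N) ℤ) := by
  classical
  ext m
  have hX : ∀ κ : ProperColoring P (Fin N), ∏ v, (X (κ.1 v) : MvPolynomial (Fin N) ℤ) =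
      monomial (∑ v, Finsupp.single (κ.1 v) 1) 1 := fun κ => (monomial_sum_one _ _).symm
  have hw : ∀ κ : P → Fin N, weight (fun v => (κ v : ℕ)) =
      (∑ v, Finsupp.single (κ v) 1 : Fin N →₀ ℕ).embDomain Fin.valEmbedding := by
    intro κ
    simp [weight, Finsupp.embDomain_eq_mapDomain, Finsupp.mapDomain_finsetSum,
      Finsupp.mapDomain_single]
  rw [coeff_restrictVars, MvPolynomial.coeff_coe, chromaticPoly, coeff_sum]
  simp only [hX, coeff_monomial]
  rw [Finset.sum_boole, ← Fintype.card_subtype, ← Nat.card_eq_fintype_card]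
  change (Nat.card {κ : (incGraph P).Coloring ℕ // weight κ = m.embDomain Fin.valEmbedding} : ℤ)
    = _
  let F : {κ : ProperColoring P (Fin N) // ∑ v, Finsupp.single (κ.1 v) 1 = m} →
      {κ : (incGraph P).Coloring ℕ // weight κ = m.embDomain Fin.valEmbedding} := fun κ =>
    ⟨SimpleGraph.Coloring.mk (fun v => (κ.1.1 v : ℕ))
      fun h => Fin.val_injective.ne (κ.1.2 _ _ h), (hw κ.1.1).trans (by rw [κ.2])⟩
  have hF : ∀ κ v, (F κ).1 v = κ.1.1 v := fun _ _ => rfl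
  refine congrArg _ (Nat.card_congr (Equiv.ofBijective F ⟨?_, ?_⟩)).symm
  · intro κ κ' h
    refine Subtype.ext (Subtype.ext (funext fun v => Fin.ext ?_))
    rw [← hF, h, hF]
  · rintro ⟨κ, hκ⟩
    have hlt : ∀ v, κ v < N := by
      intro v
      have : κ v ∈ (weight κ).support := mem_support_weight.mpr ⟨v, rfl⟩
      rw [hκ, Finsupp.support_embDomain, Finset.mem_map] at this
      obtain ⟨i, -, hi⟩ := this
      rw [← hi]
      exact i.2
    have hprop : ∀ u v, (incGraph P).Adj u v →
        (⟨κ u, hlt u⟩ : Fin N) ≠ ⟨κ v, hlt v⟩ :=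
      fun u v h h' => κ.valid h (congrArg Fin.val h')
    have hsum : ∑ v, Finsupp.single (⟨κ v, hlt v⟩ : Fin N) 1 = m :=
      Finsupp.embDomain_injective Fin.valEmbedding ((hw fun v => ⟨κ v, hlt v⟩).symm.trans hκ)
    exact ⟨⟨⟨fun v => ⟨κ v, hlt v⟩, hprop⟩, hsum⟩, Subtype.ext (RelHom.ext fun v => rfl)⟩

end Restriction

/-! ### Uniqueness of the expansion -/

section Partitions

/-- The multiset of the numbers `k - 1`, for `k` running over the parts, as a finitely supported
function. -/
def partExponents (lam : YoungDiagram) : ℕ →₀ ℕ :=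
  Multiset.toFinsupp ((lam.rowLens : Multiset ℕ).map Nat.pred)

theorem map_succ_map_pred_rowLens (lam : YoungDiagram) :
    ((lam.rowLens : Multiset ℕ).map Nat.pred).map Nat.succ = lam.rowLens := by
  rw [Multiset.map_map]
  refine (Multiset.map_congr rfl fun k hk => ?_).trans (Multiset.map_id _)
  exact Nat.succ_pred_eq_of_pos (lam.pos_of_mem_rowLens k hk)

theorem eq_of_rowLens_perm {lam mu : YoungDiagram}
    (h : (lam.rowLens : Multiset ℕ) = mu.rowLens) : lam = mu :=
  YoungDiagram.equivListRowLens.injective (Subtype.ext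
    ((Multiset.coe_eq_coe.mp h).eq_of_sortedGE lam.rowLens_sorted mu.rowLens_sorted))

theorem partExponents_injective : Function.Injective partExponents := by
  intro lam mu h
  have h' := congrArg (Multiset.map Nat.succ) (Multiset.toFinsupp.injective h)
  rw [map_succ_map_pred_rowLens, map_succ_map_pred_rowLens] at h'
  exact eq_of_rowLens_perm h'

theorem partExponents_surjective : Function.Surjective partExponents := by
  intro d
  set s : Multiset ℕ := (Finsupp.toMultiset d).map Nat.succ with hs
  have hsort : (s.sort (· ≥ ·)).SortedGE := (Multiset.pairwise_sort s (· ≥ ·)).sortedGE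
  have hpos : ∀ x ∈ s.sort (· ≥ ·), 0 < x := by
    intro x hx
    rw [Multiset.mem_sort, hs, Multiset.mem_map] at hx
    obtain ⟨y, -, rfl⟩ := hx
    exact Nat.succ_pos y
  refine ⟨YoungDiagram.ofRowLens _ hsort, ?_⟩
  rw [partExponents, YoungDiagram.rowLens_ofRowLens_eq_self hpos, Multiset.sort_eq, hs,
    Multiset.map_map]
  simp

open MvPolynomial

/-- The algebra map sending the `i`-th variable to `e_{i + 1}`. -/
def elemSymmHom : MvPolynomial ℕ ℤ →ₐ[ℤ] MvPowerSeries ℕ ℤ := aeval fun i => elemSymm (i + 1)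

theorem elemSymmHom_monomial (lam : YoungDiagram) :
    elemSymmHom (monomial (partExponents lam) 1) = elemSymmPart lam := by
  have key : ∀ s : Multiset ℕ, elemSymmHom (monomial (Multiset.toFinsupp s) 1) =
      ((s.map Nat.succ).map elemSymm).prod := by
    intro s
    induction s using Multiset.induction_on with
    | empty => simp [MvPolynomial.monomial_zero']
    | cons i s ih =>
      rw [← Multiset.singleton_add, map_add, Multiset.toFinsupp_singleton,
        ← one_mul (1 : ℤ), ← monomial_mul, map_mul, ih, Multiset.map_add, Multiset.map_add,
        Multiset.prod_add]
      congr 1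
      change elemSymmHom (X i) = _
      simp [elemSymmHom]
  rw [partExponents, key, map_succ_map_pred_rowLens, elemSymmPart, Multiset.map_coe,
    Multiset.prod_coe]

/-- The polynomial in the elementary symmetric functions with a given family of coefficients. -/
def expansionPoly (a : YoungDiagram →₀ ℤ) : MvPolynomial ℕ ℤ :=
  a.sum fun lam z => monomial (partExponents lam) z

theorem elemSymmHom_expansionPoly (a : YoungDiagram →₀ ℤ) :
    elemSymmHom (expansionPoly a) = a.sum fun lam z => z • elemSymmPart lam := by
  rw [expansionPoly, Finsupp.sum, Finsupp.sum, map_sum]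
  refine Finset.sum_congr rfl fun lam _ => ?_
  rw [← elemSymmHom_monomial, ← map_smul, smul_monomial, smul_eq_mul, mul_one]

theorem coeff_expansionPoly (a : YoungDiagram →₀ ℤ) (lam : YoungDiagram) :
    (expansionPoly a).coeff (partExponents lam) = a lam := by
  classical
  rw [expansionPoly, Finsupp.sum, coeff_sum]
  simp only [coeff_monomial, partExponents_injective.eq_iff]
  simp [eq_comm]

theorem expansionPoly_surjective : Function.Surjective expansionPoly := by
  intro p
  refine ⟨Finsupp.comapDomain partExponents (AddMonoidAlgebra.coeff p)
    partExponents_injective.injOn, ?_⟩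
  ext d
  obtain ⟨lam, rfl⟩ := partExponents_surjective d
  rw [coeff_expansionPoly]
  rfl

theorem restrictVars_elemSymmHom_rename {N : ℕ} (q : MvPolynomial (Fin N) ℤ) :
    restrictVars N (elemSymmHom (rename Fin.val q)) =
      ((esymmAlgHom (Fin N) ℤ N q).1 : MvPowerSeries (Fin N) ℤ) := by
  rw [esymmAlgHom_apply]
  induction q using MvPolynomial.induction_on with
  | C z =>
    simp only [elemSymmHom, map_intCast, eq_intCast]
    exact (map_intCast (coeToMvPowerSeries.ringHom (σ := Fin N) (R := ℤ)) z).symm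
  | add p q hp hq => simp only [map_add, hp, hq, coe_add]
  | mul_X p i hp =>
    simp only [map_mul, hp, coe_mul, rename_X, aeval_X]
    congr 1
    rw [elemSymmHom, aeval_X, restrictVars_elemSymm]

/-- A polynomial relation involves only finitely many `e_k`, and `e_1, …, e_N` are already
algebraically independent in `N` variables. -/
theorem elemSymmHom_injective : Function.Injective elemSymmHom := by
  rw [injective_iff_map_eq_zero]
  intro p hp
  obtain ⟨N, hN⟩ : ∃ N, N = p.vars.sup id + 1 := ⟨_, rfl⟩
  obtain ⟨q, rfl⟩ := exists_rename_eq_of_vars_subset_range p (Fin.val : Fin N → ℕ)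
    Fin.val_injective (by
      intro i hi
      have : i ≤ p.vars.sup id := Finset.le_sup (f := id) hi
      exact ⟨⟨i, by omega⟩, rfl⟩)
  have h := restrictVars_elemSymmHom_rename q
  rw [hp, map_zero, ← MvPolynomial.coe_zero, MvPolynomial.coe_inj] at h
  have h0 : esymmAlgHom (Fin N) ℤ N q = 0 := Subtype.ext h.symm
  rw [(injective_iff_map_eq_zero _).mp (esymmAlgHom_injective ℤ (by simp)) q h0, map_zero]

theorem IsElemExpansion.unique {f : MvPowerSeries ℕ ℤ} {a b : YoungDiagram →₀ ℤ}
    (ha : IsElemExpansion f a) (hb : IsElemExpansion f b) : a = b := by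
  rw [IsElemExpansion, ← elemSymmHom_expansionPoly] at ha hb
  have h := elemSymmHom_injective (ha.symm.trans hb)
  ext lam
  rw [← coeff_expansionPoly, h, coeff_expansionPoly]

end Partitions

/-! ### Existence of the expansion -/

section Existence

open MvPolynomial

theorem elemSymm_isHomogeneous (k : ℕ) : (elemSymm k).IsHomogeneous k := by
  intro m hm
  rw [coeff_elemSymm] at hm
  split_ifs at hm with h
  · obtain ⟨h1, rfl⟩ := h
    change Finsupp.weight (fun _ => 1) m = _
    rw [← Finsupp.degree_eq_weight_one, Finsupp.degree_apply, Finset.card_eq_sum_ones]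
    refine Finset.sum_congr rfl fun i hi => ?_
    have := h1 i
    have := Finsupp.mem_support_iff.mp hi
    omega
  · exact absurd rfl hm

theorem elemSymmPart_isHomogeneous (lam : YoungDiagram) :
    (elemSymmPart lam).IsHomogeneous lam.rowLens.sum := by
  rw [elemSymmPart]
  induction lam.rowLens with
  | nil =>
    intro m hm
    classical
    simp only [List.map_nil, List.prod_nil, MvPowerSeries.coeff_one, ne_eq, ite_eq_right_iff,
      one_ne_zero, imp_false, not_not] at hm
    simp [hm]
  | cons k l ih =>
    rw [List.map_cons, List.prod_cons, List.sum_cons]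
    exact MvPowerSeries.IsHomogeneous.mul (elemSymm_isHomogeneous k) ih

/-- `MvPowerSeries.killCompl` along a bijection merely renames the variables, and it fixes each
generator `elemSymm (i + 1)`. -/
theorem coeff_embDomain_elemSymmHom (p : MvPolynomial ℕ ℤ) (σ : Equiv.Perm ℕ) (m : ℕ →₀ ℕ) :
    MvPowerSeries.coeff (m.embDomain σ.toEmbedding) (elemSymmHom p) =
      MvPowerSeries.coeff m (elemSymmHom p) := by
  have h : (MvPowerSeries.killCompl σ.toEmbedding).comp elemSymmHom = elemSymmHom := by
    refine algHom_ext fun i => ?_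
    simp only [AlgHom.comp_apply, elemSymmHom, aeval_X]
    ext m
    rw [MvPowerSeries.coeff_killCompl, coeff_elemSymm, coeff_elemSymm,
      Finsupp.support_embDomain, Finset.card_map]
    have : (∀ i, (m.embDomain σ.toEmbedding) i ≤ 1) ↔ ∀ i, m i ≤ 1 := by
      rw [← σ.toEmbedding.equivOfSurjective σ.surjective |>.forall_congr_right]
      refine forall_congr' fun i => ?_
      exact iff_of_eq (congrArg (· ≤ 1) (Finsupp.embDomain_apply_self σ.toEmbedding m i))
    rw [this]
  rw [← MvPowerSeries.coeff_killCompl, ← AlgHom.comp_apply, h]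

theorem coeff_embDomain_chromaticSymm {V : Type*} [Fintype V] (G : SimpleGraph V)
    (σ : Equiv.Perm ℕ) (m : ℕ →₀ ℕ) :
    MvPowerSeries.coeff (m.embDomain σ.toEmbedding) (chromaticSymm G) =
      MvPowerSeries.coeff m (chromaticSymm G) := by
  change (Nat.card {κ : G.Coloring ℕ // weight κ = m.embDomain σ.toEmbedding} : ℤ) =
    (Nat.card {κ : G.Coloring ℕ // weight κ = m} : ℤ)
  have hw : ∀ (τ : Equiv.Perm ℕ) (κ : G.Coloring ℕ), weight (fun v => τ (κ v)) =
      (weight κ).embDomain τ.toEmbedding := by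
    intro τ κ
    rw [Finsupp.embDomain_eq_mapDomain]
    exact weight_comp κ τ
  let F : {κ : G.Coloring ℕ // weight κ = m} →
      {κ : G.Coloring ℕ // weight κ = m.embDomain σ.toEmbedding} := fun κ =>
    ⟨SimpleGraph.Coloring.mk (fun v => σ (κ.1 v)) fun h => σ.injective.ne (κ.1.valid h),
      (hw σ κ.1).trans (by rw [κ.2])⟩
  have hF : ∀ κ v, (F κ).1 v = σ (κ.1 v) := fun _ _ => rfl
  refine congrArg _ (Nat.card_congr (Equiv.ofBijective F ⟨?_, ?_⟩)).symm
  · intro κ κ' h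
    refine Subtype.ext (RelHom.ext fun v => σ.injective ?_)
    rw [← hF, h, hF]
  · rintro ⟨κ, hκ⟩
    refine ⟨⟨SimpleGraph.Coloring.mk (fun v => σ.symm (κ v))
      fun h => σ.symm.injective.ne (κ.valid h), ?_⟩, ?_⟩
    · refine Finsupp.embDomain_injective σ.toEmbedding ?_
      rw [← hκ]
      refine (congrArg _ (hw σ.symm κ)).trans ?_
      rw [Finsupp.embDomain_eq_mapDomain, Finsupp.embDomain_eq_mapDomain,
        ← Finsupp.mapDomain_comp]
      simp
    · exact Subtype.ext (RelHom.ext fun v => σ.apply_symm_apply (κ v))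

theorem exists_perm_embDomain {n : ℕ} {m : ℕ →₀ ℕ} (hm : m.support.card ≤ n) :
    ∃ (σ : Equiv.Perm ℕ) (m' : Fin n →₀ ℕ),
      m.embDomain σ.toEmbedding = m'.embDomain Fin.valEmbedding := by
  classical
  -- The support is padded to exactly `n` elements, because permutations act transitively on sets of
  -- a fixed size.
  obtain ⟨t, hmt, ht⟩ := Infinite.exists_superset_card_eq m.support n hm
  obtain ⟨σ, hσ⟩ := (Set.powersetCard.isPretransitive (α := ℕ) (n := n)).exists_smul_eq
    ⟨t, ht⟩ ⟨Finset.range n, Finset.card_range n⟩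
  have hσ' : ∀ i ∈ t, σ i < n := by
    intro i hi
    have h1 := congrArg (fun s : Set.powersetCard ℕ n => (s : Finset ℕ)) hσ
    have h2 : σ i ∈ Finset.range n := by
      rw [← show _ = Finset.range n from h1]
      exact Finset.smul_mem_smul_finset hi
    exact Finset.mem_range.mp h2
  refine ⟨σ, (m.embDomain σ.toEmbedding).comapDomain Fin.val Fin.val_injective.injOn, ?_⟩
  rw [Finsupp.embDomain_eq_mapDomain Fin.valEmbedding]
  refine (Finsupp.mapDomain_comapDomain _ Fin.val_injective _ ?_).symm
  intro i hi
  rw [Finset.mem_coe, Finsupp.support_embDomain, Finset.mem_map] at hi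
  obtain ⟨j, hj, rfl⟩ := hi
  exact ⟨⟨σ j, hσ' j (hmt hj)⟩, rfl⟩

theorem card_support_le_degree (m : ℕ →₀ ℕ) : m.support.card ≤ m.degree := by
  rw [Finsupp.degree_apply, Finset.card_eq_sum_ones]
  exact Finset.sum_le_sum fun i hi => Nat.one_le_iff_ne_zero.mpr (Finsupp.mem_support_iff.mp hi)

variable (P : Type*) [PartialOrder P] [Fintype P]

/-- A monomial of degree `n = |P|` has at most `n` variables, and up to a permutation these are the
first `n`. Both sides being symmetric, their agreement after truncation to `n` variables settles all
coefficients of degree `n`. -/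
theorem exists_isElemExpansion : ∃ a : YoungDiagram →₀ ℤ,
    IsElemExpansion (chromaticSymm (incGraph P)) a ∧
      ∀ lam, a lam ≠ 0 → lam.rowLens.sum = Fintype.card P := by
  classical
  set n := Fintype.card P with hn
  obtain ⟨q, hq⟩ := esymmAlgHom_surjective ℤ (σ := Fin n) (n := n) (by simp)
    ⟨chromaticPoly P n, chromaticPoly_isSymmetric P n⟩
  obtain ⟨b, hb⟩ := expansionPoly_surjective (rename Fin.val q)
  have hX : ∀ m : ℕ →₀ ℕ, m.degree = n →
      MvPowerSeries.coeff m (chromaticSymm (incGraph P)) =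
        MvPowerSeries.coeff m (elemSymmHom (expansionPoly b)) := by
    intro m hm
    obtain ⟨σ, m', h⟩ := exists_perm_embDomain ((card_support_le_degree m).trans hm.le)
    rw [← coeff_embDomain_chromaticSymm _ σ, ← coeff_embDomain_elemSymmHom _ σ, h,
      ← coeff_restrictVars, ← coeff_restrictVars, restrictVars_chromaticSymm, hb,
      restrictVars_elemSymmHom_rename, hq]
  have hX0 : ∀ m : ℕ →₀ ℕ, m.degree ≠ n →
      MvPowerSeries.coeff m (chromaticSymm (incGraph P)) = 0 := by
    intro m hm
    change (Nat.card {κ : (incGraph P).Coloring ℕ // weight κ = m} : ℤ) = 0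
    have : IsEmpty {κ : (incGraph P).Coloring ℕ // weight κ = m} :=
      ⟨fun κ => hm (by rw [← κ.2, degree_weight])⟩
    simp
  -- The lifted polynomial may have terms of other degrees in infinitely many variables. Discarding
  -- them leaves degree `n` unchanged, since each `elemSymmPart` is homogeneous.
  refine ⟨b.filter fun lam : YoungDiagram => lam.rowLens.sum = n, ?_, ?_⟩
  · rw [IsElemExpansion]
    ext m
    rw [elemSymmHom_expansionPoly] at hX
    simp only [Finsupp.sum, map_sum] at hX ⊢
    rw [Finsupp.support_filter, Finset.sum_filter]
    by_cases hm : m.degree = n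
    · rw [hX m hm]
      refine Finset.sum_congr rfl fun lam _ => ?_
      split_ifs with h
      · rw [Finsupp.filter_apply_pos (fun lam : YoungDiagram => lam.rowLens.sum = n) b h]
      · rw [map_smul, MvPowerSeries.IsHomogeneous.coeff_eq_zero (elemSymmPart_isHomogeneous lam) (by rw [hm]; exact Ne.symm h),
          smul_zero]
    · rw [hX0 m hm]
      refine (Finset.sum_eq_zero fun lam _ => ?_).symm
      split_ifs with h
      · rw [map_smul, MvPowerSeries.IsHomogeneous.coeff_eq_zero (elemSymmPart_isHomogeneous lam) (by rwa [h]), smul_zero]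
      · rfl
  · intro lam h
    by_contra h'
    exact h (Finsupp.filter_apply_neg _ _ h')

end Existence

/-! ### Specializing the expansion at roots of unity -/

section RootsOfUnity

open MvPolynomial

theorem rowLens_rect (r c : ℕ) [NeZero r] : (rect r c).rowLens = List.replicate c r := by
  rw [List.eq_replicate_iff, YoungDiagram.length_rowLens,
    colLen_rect (Nat.pos_of_ne_zero (NeZero.ne r))]
  refine ⟨rfl, fun k hk => ?_⟩
  rw [YoungDiagram.rowLens, List.mem_map] at hk
  obtain ⟨i, hi, rfl⟩ := hk
  rw [List.mem_range, colLen_rect (Nat.pos_of_ne_zero (NeZero.ne r))] at hi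
  exact rowLen_rect hi

theorem exists_roots_of_unity (r : ℕ) [NeZero r] :
    ∃ z : Fin r → ℂ, Function.Injective z ∧ ∀ i, z i ^ r = 1 := by
  have h := Complex.isPrimitiveRoot_exp r (NeZero.ne r)
  refine ⟨fun i => Complex.exp (2 * Real.pi * Complex.I / r) ^ (i : ℕ), fun i j hij => ?_,
    fun i => ?_⟩
  · exact Fin.ext (h.pow_inj i.2 j.2 hij)
  · rw [← pow_mul, Nat.mul_comm, pow_mul, h.pow_eq_one, one_pow]

variable {r : ℕ} [NeZero r] {z : Fin r → ℂ}

/-- For `k < r`, Vieta identifies the value up to sign with a middle coefficient of `X^r - 1`. For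
`k > r` there are too few variables. -/
theorem aeval_esymm_eq_zero (hinj : Function.Injective z) (hz : ∀ i, z i ^ r = 1) {k : ℕ}
    (hk : 0 < k) (hkr : k ≠ r) : aeval z (esymm (Fin r) ℤ k) = 0 := by
  rcases lt_or_gt_of_ne hkr with hlt | hgt
  · have hr : 0 < r := Nat.pos_of_ne_zero (NeZero.ne r)
    rw [aeval_esymm_eq_multiset_esymm]
    have hroots : Finset.univ.val.map z = (Polynomial.X ^ r - Polynomial.C (1 : ℂ)).roots := by
      refine Multiset.eq_of_le_of_card_le ?_ ?_
      · rw [Multiset.le_iff_subset ((Multiset.nodup_map_iff_of_injective hinj).mpr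
          Finset.univ.nodup)]
        intro x hx
        obtain ⟨i, -, rfl⟩ := Multiset.mem_map.mp hx
        exact (Polynomial.mem_nthRoots hr).mpr (hz i)
      · rw [Multiset.card_map, Finset.card_val, Finset.card_univ, Fintype.card_fin]
        exact Polynomial.card_nthRoots r (1 : ℂ)
    have hdeg : (Polynomial.X ^ r - Polynomial.C (1 : ℂ)).natDegree = r :=
      Polynomial.natDegree_X_pow_sub_C
    have h := Polynomial.coeff_eq_esymm_roots_of_card
      (p := Polynomial.X ^ r - Polynomial.C (1 : ℂ)) (k := r - k)
      (by rw [← hroots, hdeg]; simp) (by rw [hdeg]; omega)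
    rw [← hroots, hdeg, (Polynomial.monic_X_pow_sub_C (1 : ℂ) hr.ne').leadingCoeff, one_mul,
      Nat.sub_sub_self hlt.le, Polynomial.coeff_sub, Polynomial.coeff_X_pow,
      Polynomial.coeff_C, if_neg (by omega), if_neg (by omega), sub_zero] at h
    exact (mul_eq_zero.mp h.symm).resolve_left (pow_ne_zero _ (by norm_num))
  · rw [esymm, Finset.powersetCard_eq_empty.mpr (by simpa using hgt)]
    simp

theorem aeval_esymm_self : aeval z (esymm (Fin r) ℤ r) = ∏ i, z i := by
  have : Finset.powersetCard r (Finset.univ : Finset (Fin r)) = {Finset.univ} := by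
    simpa using Finset.powersetCard_self (Finset.univ : Finset (Fin r))
  simp [esymm, this]

open Classical in
theorem prod_aeval_esymm (hinj : Function.Injective z) (hz : ∀ i, z i ^ r = 1) {c : ℕ}
    {lam : YoungDiagram} (hlam : lam.rowLens.sum = r * c) :
    (lam.rowLens.map fun k => aeval z (esymm (Fin r) ℤ k)).prod =
      if lam = rect r c then (∏ i, z i) ^ c else 0 := by
  split_ifs with h
  · rw [h, rowLens_rect, List.map_replicate, List.prod_replicate, aeval_esymm_self]
  · rw [List.prod_eq_zero_iff, List.mem_map]
    by_contra! hne
    refine h (eq_of_rowLens_perm ?_)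
    have hall : ∀ k ∈ lam.rowLens, k = r := by
      intro k hk
      by_contra hkr
      exact hne k hk (aeval_esymm_eq_zero hinj hz (lam.pos_of_mem_rowLens k hk) hkr)
    have hrep := List.eq_replicate_of_mem hall
    have hlen : lam.rowLens.length = c := by
      rw [hrep, List.sum_replicate, smul_eq_mul, mul_comm] at hlam
      exact Nat.eq_of_mul_eq_mul_left (Nat.pos_of_ne_zero (NeZero.ne r)) hlam
    rw [hrep, hlen, rowLens_rect]

variable {P : Type*} [PartialOrder P] [Fintype P]

theorem sum_coloring_eq_coeff (hinj : Function.Injective z) (hz : ∀ i, z i ^ r = 1) {c : ℕ}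
    (hcard : Fintype.card P = r * c) {a : YoungDiagram →₀ ℤ}
    (ha : IsElemExpansion (chromaticSymm (incGraph P)) a)
    (hdeg : ∀ lam, a lam ≠ 0 → lam.rowLens.sum = Fintype.card P) :
    ∑ κ : ProperColoring P (Fin r), ∏ v, z (κ.1 v) = a (rect r c) * (∏ i, z i) ^ c := by
  classical
  have h1 : chromaticPoly P r =
      ∑ lam ∈ a.support, a lam • (lam.rowLens.map (esymm (Fin r) ℤ)).prod := by
    rw [← MvPolynomial.coe_inj, ← restrictVars_chromaticSymm, ha, Finsupp.sum, map_sum,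
      ← coeToMvPowerSeries.ringHom_apply, map_sum]
    refine Finset.sum_congr rfl fun lam _ => ?_
    rw [map_smul, restrictVars_elemSymmPart, map_zsmul, coeToMvPowerSeries.ringHom_apply]
  have h2 := congrArg (aeval z) h1
  simp only [chromaticPoly, map_sum, map_prod, aeval_X, map_zsmul, map_list_prod,
    List.map_map] at h2
  rw [h2, Finset.sum_congr rfl (g := fun lam => if lam = rect r c then
    a lam * (∏ i, z i) ^ c else 0), Finset.sum_ite_eq']
  · split_ifs with h
    · rfl
    · rw [Finsupp.notMem_support_iff.mp h]
      simp
  · intro lam hlam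
    have := prod_aeval_esymm hinj hz ((hdeg lam (Finsupp.mem_support_iff.mp hlam)).trans hcard)
    rw [zsmul_eq_mul, show (aeval z ∘ esymm (Fin r) ℤ : ℕ → ℂ) =
      fun k => aeval z (esymm (Fin r) ℤ k) from rfl, this, mul_ite, mul_zero]

end RootsOfUnity

/-! ### Cylindric Schur functions of rectangles -/

section CylindricSchur

variable {r c : ℕ} [NeZero r]

/-- The semistandard tableaux of shape `(r^c) / ∅ / 0` have constant rows. -/
theorem isCylindricPTableau_rect_nat_iff
    (T : SkewCell (rectShape r c).outer (rectShape r c).inner → ℕ) :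
    IsCylindricPTableau (rectShape r c) T ↔
      ∃ t : Fin c → ℕ, StrictMono t ∧ T = fun b => t (rectCellEquiv r c b).1 := by
  rw [isCylindricPTableau_rect_iff]
  constructor
  · rintro ⟨h1, h2⟩
    refine ⟨fun i => T ((rectCellEquiv r c).symm (i, 0)), ?_, ?_⟩
    · rcases c with _ | c
      · exact fun i => i.elim0
      · exact Fin.strictMono_iff_lt_succ.mpr fun i => h1 _ _ _ (by simp)
    · funext b
      obtain ⟨⟨i, j⟩, rfl⟩ := (rectCellEquiv r c).symm.surjective b
      rw [Equiv.apply_symm_apply]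
      -- The order is reversed because rows increase weakly while the lemma expects a weakly
      -- decreasing cycle.
      exact eq_of_forall_add_one_le (α := ℕᵒᵈ)
        (g := fun j => OrderDual.toDual (T ((rectCellEquiv r c).symm (i, j))))
        (fun j => not_lt.mp (h2 i j)) j 0
  · rintro ⟨t, ht, rfl⟩
    simp only [Equiv.apply_symm_apply]
    exact ⟨fun i i' j hi => ht (Fin.lt_def.mpr (by omega)), fun i j => lt_irrefl _⟩

theorem weight_rect (t : Fin c → ℕ) :
    weight (fun b => t (rectCellEquiv r c b).1) = r • weight t := by
  rw [weight, Fintype.sum_equiv (rectCellEquiv r c) _ (fun x => Finsupp.single (t x.1) 1)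
    (fun _ => rfl), Fintype.sum_prod_type]
  simp [weight, Finset.smul_sum]

theorem weight_apply_of_injective {t : Fin c → ℕ} (ht : Function.Injective t) (x : ℕ) :
    weight t x = if x ∈ Finset.univ.image t then 1 else 0 := by
  rw [← sum_single_apply, Finset.sum_image ht.injOn, weight]

theorem cylindricSchur_rect_of_neZero :
    cylindricSchur (rectShape r c) = monoSymm (rect r c) := by
  classical
  have hr : r ≠ 0 := NeZero.ne r
  funext m
  have hcard : Nat.card {T : SkewCell (rectShape r c).outer (rectShape r c).inner → ℕ //
      IsCylindricPTableau (rectShape r c) T ∧ weight T = m} =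
      Nat.card {t : Fin c → ℕ // StrictMono t ∧ r • weight t = m} := by
    refine (Nat.card_congr (Equiv.ofBijective (fun t => ⟨fun b => t.1 (rectCellEquiv r c b).1,
      (isCylindricPTableau_rect_nat_iff _).mpr ⟨t.1, t.2.1, rfl⟩,
      (weight_rect t.1).trans t.2.2⟩) ⟨?_, ?_⟩)).symm
    · intro t t' h
      refine Subtype.ext (funext fun i => ?_)
      have := congrFun (congrArg Subtype.val h) ((rectCellEquiv r c).symm (i, 0))
      simpa only [Equiv.apply_symm_apply] using this
    · rintro ⟨T, hT, hm⟩
      obtain ⟨t, ht, rfl⟩ := (isCylindricPTableau_rect_nat_iff _).mp hT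
      exact ⟨⟨t, ht, (weight_rect t).symm.trans hm⟩, rfl⟩
  have hmem : ∀ t : Fin c → ℕ, StrictMono t → r • weight t = m →
      m.support = Finset.univ.image t ∧ ∀ x ∈ m.support, m x = r := by
    rintro t ht rfl
    have hx : ∀ x, (r • weight t) x = if x ∈ Finset.univ.image t then r else 0 := by
      intro x
      rw [Finsupp.smul_apply, weight_apply_of_injective ht.injective, smul_eq_mul, mul_ite,
        mul_one, mul_zero]
    have hs : (r • weight t).support = Finset.univ.image t := by
      ext x
      rw [Finsupp.mem_support_iff, hx]
      simp [hr]
    exact ⟨hs, fun x h => by rw [hx, if_pos (hs ▸ h)]⟩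
  have hiff : m.support.val.map m = ((rect r c).rowLens : Multiset ℕ) ↔
      m.support.card = c ∧ ∀ x ∈ m.support, m x = r := by
    rw [rowLens_rect, Multiset.coe_replicate, Multiset.eq_replicate, Multiset.card_map,
      Finset.card_val]
    simp only [Multiset.mem_map, Finset.mem_val, forall_exists_index, and_imp,
      forall_apply_eq_imp_iff₂]
  simp only [cylindricSchur, monoSymm]
  rw [hcard]
  split_ifs with h
  · obtain ⟨hc, hval⟩ := hiff.mp h
    have hm : r • weight (m.support.orderEmbOfFin hc) = m := by
      ext x
      rw [Finsupp.smul_apply, weight_apply_of_injective (m.support.orderEmbOfFin hc).injective,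
        Finset.image_orderEmbOfFin_univ, smul_eq_mul]
      split_ifs with hx
      · rw [mul_one, hval x hx]
      · rw [mul_zero, Finsupp.notMem_support_iff.mp hx]
    rw [Nat.cast_eq_one, Nat.card_eq_one_iff_unique]
    -- The monomial determines the set of row values, and strict increase down the columns forces
    -- its increasing enumeration.
    refine ⟨⟨fun t t' => Subtype.ext ?_⟩,
      ⟨_, (m.support.orderEmbOfFin hc).strictMono, hm⟩⟩
    have huniq : ∀ t : {t : Fin c → ℕ // StrictMono t ∧ r • weight t = m},
        t.1 = m.support.orderEmbOfFin hc := fun t =>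
      Finset.orderEmbOfFin_unique hc
        (fun i => by rw [(hmem t.1 t.2.1 t.2.2).1]; simp) t.2.1
    rw [huniq, huniq t']
  · have : IsEmpty {t : Fin c → ℕ // StrictMono t ∧ r • weight t = m} := by
      refine ⟨fun t => h (hiff.mpr ?_)⟩
      obtain ⟨hs, hval⟩ := hmem t.1 t.2.1 t.2.2
      refine ⟨?_, hval⟩
      rw [hs, Finset.card_image_of_injective _ t.2.1.injective]
      simp
    simp

/-- This reduces `r = 0`, where there are no roots of unity to use, to an empty rectangle with `r =
1`. -/
theorem rect_zero_left (c : ℕ) : rect 0 c = rect 1 0 := by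
  refine YoungDiagram.ext ?_
  simp [rect]

theorem rectShape_zero_left (c : ℕ) : rectShape 0 c = rectShape 1 0 := by
  simp only [rectShape, rect_zero_left]

theorem cylindricSchur_rect (r c : ℕ) :
    cylindricSchur (rectShape r c) = monoSymm (rect r c) := by
  rcases Nat.eq_zero_or_pos r with rfl | hr
  · rw [rectShape_zero_left, rect_zero_left]
    exact cylindricSchur_rect_of_neZero
  · have : NeZero r := ⟨hr.ne'⟩
    exact cylindricSchur_rect_of_neZero

end CylindricSchur

/-! ### Comparing the two evaluations -/

section Coefficients

variable {P : Type*} [PartialOrder P] [Fintype P]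

theorem card_eq_of_standardCylindricPTableau {r c : ℕ}
    (T : StandardCylindricPTableau P (rectShape r c)) : Fintype.card P = r * c := by
  have hT : Function.Bijective T.1 := (Function.bijective_iff_existsUnique _).mpr T.2.2
  rw [← Fintype.card_of_bijective hT, Fintype.card_congr (rectCellEquiv r c)]
  simp [mul_comm]

theorem elemExpansion_rect_of_neZero (hP : ThreePlusOneFree P) {a : YoungDiagram →₀ ℤ}
    (ha : IsElemExpansion (chromaticSymm (incGraph P)) a)
    (hdeg : ∀ lam, a lam ≠ 0 → lam.rowLens.sum = Fintype.card P) (r c : ℕ) [NeZero r] :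
    a (rect r c) = (Nat.card (StandardCylindricPTableau P (rectShape r c)) : ℤ) := by
  by_cases hcard : Fintype.card P = r * c
  · obtain ⟨z, hinj, hz⟩ := exists_roots_of_unity r
    have h := (sum_coloring_eq_coeff hinj hz hcard ha hdeg).symm.trans
      (sum_coloring_eq_card_tableaux hP hcard hinj hz)
    have hne : (∏ i, z i) ^ c ≠ 0 := by
      refine pow_ne_zero _ (Finset.prod_ne_zero_iff.mpr fun i _ h0 => ?_)
      have := hz i
      rw [h0, zero_pow (NeZero.ne r)] at this
      exact zero_ne_one this
    exact_mod_cast mul_right_cancel₀ hne h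
  · have : IsEmpty (StandardCylindricPTableau P (rectShape r c)) :=
      ⟨fun T => hcard (card_eq_of_standardCylindricPTableau T)⟩
    rw [Nat.card_of_isEmpty, Nat.cast_zero]
    by_contra hne
    have := hdeg _ hne
    rw [rowLens_rect, List.sum_replicate, smul_eq_mul, mul_comm] at this
    exact hcard this.symm

theorem elemExpansion_rect (hP : ThreePlusOneFree P) {a : YoungDiagram →₀ ℤ}
    (ha : IsElemExpansion (chromaticSymm (incGraph P)) a) (r c : ℕ) :
    a (rect r c) = (Nat.card (StandardCylindricPTableau P (rectShape r c)) : ℤ) := by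
  obtain ⟨b, hb, hdeg⟩ := exists_isElemExpansion P
  -- Uniqueness transfers to `a` the support condition known for the constructed expansion.
  obtain rfl := ha.unique hb
  rcases Nat.eq_zero_or_pos r with rfl | hr
  · rw [rectShape_zero_left, rect_zero_left]
    exact elemExpansion_rect_of_neZero hP ha hdeg 1 0
  · have : NeZero r := ⟨hr.ne'⟩
    exact elemExpansion_rect_of_neZero hP ha hdeg r c

end Coefficients

end CylPTab

end

theorem mainTheorem3 {P : Type*} [PartialOrder P] [Fintype P]
    (hP : CylPTab.ThreePlusOneFree P) :
    (∃! a : YoungDiagram →₀ ℤ,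
      CylPTab.IsElemExpansion (CylPTab.chromaticSymm (CylPTab.incGraph P)) a) ∧
    (∀ a : YoungDiagram →₀ ℤ,
      CylPTab.IsElemExpansion (CylPTab.chromaticSymm (CylPTab.incGraph P)) a →
      ∀ r c : ℕ, a (CylPTab.rect r c) =
        (Nat.card (CylPTab.StandardCylindricPTableau P (CylPTab.rectShape r c)) : ℤ)) ∧
    (∀ r c : ℕ, CylPTab.cylindricSchur (CylPTab.rectShape r c) =
      CylPTab.monoSymm (CylPTab.rect r c)) := by
  refine ⟨?_, fun a ha r c => CylPTab.elemExpansion_rect hP ha r c, CylPTab.cylindricSchur_rect⟩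
  obtain ⟨a, ha, -⟩ := CylPTab.exists_isElemExpansion P
  exact ⟨a, ha, fun b hb => hb.unique ha⟩
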